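/- Tuples have entries in $\mathbb N_0=\{0,1,2,\dots\}$, $\mathbb N=\{1,2,\dots\}$, and sequences are indexed from $1$. For a tuple $\epsilon$ of length $t$ and a sequence $Q$ put $\epsilon*Q=\sum_{k=1}^{t}\epsilon(k)Q_{t-k+1}$ and $\epsilon\cdot Q=\sum_{k=1}^{t}\epsilon(k)Q_k$, and write $\epsilon|s=(\epsilon(1),\dots,\epsilon(s))$ for $s\le t$. For a property $P$ of positive integers, $\mathrm{Prob}\{n\in\mathbb N: P(n)\}=\lim_{n\to\infty}\frac1n\#\{k\le n: P(k)\}$. Let $N\ge 2$ and $L=(a_1,\dots,a_N)\in\mathbb N_0^N$ with $a_1>0$, and let $\Theta=(a_1,\dots,a_N,a_1,\dots,a_N,\dots)$ be its infinite periodic repetition. Let $\mathcal H^\circ$ be the recursively defined set of finite tuples $\epsilon$ such that either $\epsilon=\Theta|\mathrm{len}(\epsilon)$, or there is $0\le s<\mathrm{len}(\epsilon)$ with $\epsilon|s=\Theta|s$, $\epsilon(s+1)<\Theta(s+1)$ and $(\epsilon(s+2),\dots,\epsilon(\mathrm{len}(\epsilon)))\in\mathcal H^\circ$ (the empty tuple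 belongs to $\mathcal H^\circ$). The periodic Zeckendorf collection of $L$ is $\mathcal H=\{\epsilon\in\mathcal H^\circ:\epsilon(1)>0\}$. Let $H$ be its fundamental sequence, i.e. the increasing sequence of positive integers such that every $n\in\mathbb N$ is $\epsilon*H$ for a unique $\epsilon\in\mathcal H$ (the $\mathcal H$-expansion of $n$). Let $\psi$ be the dominant real zero of $x^N-\sum_{k=1}^{N-1}a_kx^{N-k}-(1+a_N)$, and let $\widehat H_n=\psi^{-(n-1)}$. For $s\ge1$ and $n=\epsilon*H$ with $\epsilon\in\mathcal H$, $\mathrm{len}(\epsilon)\ge s$, let $\mathrm{LB}_s(n)=\epsilon|s$ if $s\ge N$, and $\mathrm{LB}_s(n)=(\epsilon(1),\dots,\epsilon(s),0,\dots,0)\in\mathbb N_0^N$ if $s<N$; $\mathrm{LB}_s(n)$ is undefined if $\mathrm{len}(\epsilon)<s$. If $s\ge N$, let $\mathcal H_s$ be the set of all $\mathrm{LB}_s(n)$, $n\in\mathbb N$; if $1\le s<N$, let $\mathcal H_s$ be the set of all $\mathrm{LB}_N(n)$, $n\in\mathbb N$, whose entries after the $s$-th one are $0$. Enumerate $\mathcal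 H_s=\{\mathbf b_1,\dots,\mathbf b_\ell\}$ so that $1+(\mathbf b_k|s)*H=(\mathbf b_{k+1}|s)*H$ for $1\le k<\ell$. Define $\mathbf b_{\ell+1}=(a_1,\dots,a_{N-1},1+a_N)$ if $s<N$; if $s\ge N$, write $s=qN+p$ with $0\le p<N$ and let $\mathbf b_{\ell+1}$ be the tuple of length $s$ that consists of $q-1$ copies of $L$, followed by $(a_1,\dots,a_{N-1},1+a_N)$ and by $p$ zeros. For $\mathbf b=\mathbf b_k\in\mathcal H_s$ put $\widetilde{\mathbf b}=\mathbf b_{k+1}$. **Theorem.** Let $K$ be a sequence of positive integers such that $K_n=ab^n(1+o(1))$ as $n\to\infty$, where $a$ and $b$ are positive real numbers with $\log_\psi b$ irrational. Then, for every $s\ge1$ and every $\mathbf b\in\mathcal H_s$, the following limit exists and $$\mathrm{Prob}\{n\in\mathbb N:\mathrm{LB}_s(K_n)=\mathbf b\}=\log_\psi\frac{\widetilde{\mathbf b}\cdot\widehat H}{\mathbf b\cdot\widehat H}.$$ -/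

import Mathlib

open Filter Topology Polynomial Asymptotics

namespace GenZeckendorf

/-! Tuples are lists of natural numbers; the `k`-th entry (`k ≥ 1`) of a tuple `ε` is
`ε.getD (k - 1) 0`. A sequence `Q = (Q_1, Q_2, …)` is a function on `ℕ` of which only the values
at `n ≥ 1` are used. -/

/-- The product `ε * Q = ∑_{k=1}^t ε(k) Q_{t-k+1}`, where `t` is the length of `ε`
(below, `i = k - 1`). -/
def conv (ε : List ℕ) (Q : ℕ → ℕ) : ℕ :=
  ∑ i ∈ Finset.range ε.length, ε.getD i 0 * Q (ε.length - i)

/-- The product `ε · Q = ∑_{k=1}^t ε(k) Q_k`, where `t` is the length of `ε`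
(below, `i = k - 1`). -/
def dot (ε : List ℕ) (Q : ℕ → ℝ) : ℝ :=
  ∑ i ∈ Finset.range ε.length, (ε.getD i 0 : ℝ) * Q (i + 1)

/-- The entry `Θ(i + 1)` of the infinite periodic tuple `Θ = (L, L, L, …)`. -/
def theta (L : List ℕ) (i : ℕ) : ℕ := L.getD (i % L.length) 0

/-- The truncation `Θ|s = (Θ(1), …, Θ(s))`. -/
def thetaTake (L : List ℕ) (s : ℕ) : List ℕ := (List.range s).map (theta L)

/-- The recursively defined set of tuples `𝓗°`: a tuple belongs to it if and only if it agrees with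
`Θ` on all of its entries (the case `s = len ε`), or it agrees with `Θ` on its first `s` entries,
its next entry is smaller than `Θ(s+1)`, and the remaining tuple (possibly empty) belongs to `𝓗°`.
The index `s` is the first place of disagreement with `Θ`, so it is unique. -/
inductive MemCirc (L : List ℕ) : List ℕ → Prop
  | full (s : ℕ) : MemCirc L (thetaTake L s)
  | step (s c : ℕ) (τ : List ℕ) (hc : c < theta L s) (hτ : MemCirc L τ) :
      MemCirc L (thetaTake L s ++ c :: τ)

/-- The periodic Zeckendorf collection with principal maximal block `L`: the members of `𝓗°`
with positive first entry. -/
def collection (L : List ℕ) : Set (List ℕ) := {ε | MemCirc L ε ∧ 0 < ε.getD 0 0}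

/-- `H` is a fundamental sequence of `C`: an increasing sequence of positive integers such that
each positive integer is `ε * H` for a unique `ε ∈ C`. -/
def IsFundamentalSequence (C : Set (List ℕ)) (H : ℕ → ℕ) : Prop :=
  (∀ n, 1 ≤ n → 0 < H n) ∧ StrictMonoOn H (Set.Ici 1) ∧
    ∀ n, 1 ≤ n → ∃! ε, ε ∈ C ∧ conv ε H = n

/-- The polynomial `x^N - ∑_{k=1}^{N-1} a_k x^{N-k} - (1 + a_N)` for `L = (a_1, …, a_N)`
(below, `i = k - 1`). -/
noncomputable def charPoly (L : List ℕ) : ℝ[X] :=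
  X ^ L.length
    - ∑ i ∈ Finset.range (L.length - 1), C (L.getD i 0 : ℝ) * X ^ (L.length - 1 - i)
    - C (1 + (L.getD (L.length - 1) 0 : ℝ))

/-- `ψ` is the dominant real zero of `p`: a real zero which is at least as large as the modulus of
every complex zero of `p` (there is at most one such number). -/
def IsDominantRealZero (p : ℝ[X]) (ψ : ℝ) : Prop :=
  p.IsRoot ψ ∧ ∀ z : ℂ, aeval z p = 0 → ‖z‖ ≤ ψ

/-- The sequence `Ĥ_n = ψ^{-(n-1)}`, `n ≥ 1`. -/
noncomputable def hatSeq (ψ : ℝ) (n : ℕ) : ℝ := ψ⁻¹ ^ (n - 1)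

/-- `LB_s(n) = b`: the tuple `b` consists of the first `s` entries of the `𝓗`-expansion `ε * H`
of `n` (which has to have length at least `s`), padded by zeros to length `N = len L` if `s < N`;
for `s ≥ N` the truncated difference `N - s` is zero and nothing is added. -/
def IsLB (L : List ℕ) (H : ℕ → ℕ) (s n : ℕ) (b : List ℕ) : Prop :=
  ∃ ε ∈ collection L, conv ε H = n ∧ s ≤ ε.length ∧
    b = ε.take s ++ List.replicate (L.length - s) 0

/-- The set `𝓗_s` of leading blocks: if `s ≥ N`, the leading blocks of length `s` of positive
integers (the condition on `j` is then void); if `s < N`, the leading blocks of length `N` of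
positive integers whose entries after the `s`-th one are zero. -/
def leadingBlocks (L : List ℕ) (H : ℕ → ℕ) (s : ℕ) : Set (List ℕ) :=
  {b | (∃ n, 1 ≤ n ∧ IsLB L H (max s L.length) n b) ∧ ∀ j, s ≤ j → b.getD j 0 = 0}

/-- The tuple `(a_1, …, a_{N-1}, 1 + a_N)`. -/
def bump (L : List ℕ) : List ℕ := L.take (L.length - 1) ++ [1 + L.getD (L.length - 1) 0]

/-- The exclusive block `b_{ℓ+1}`: if `s < N`, it is `(a_1, …, a_{N-1}, 1 + a_N)`; if `s ≥ N`, it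
has length `s` and consists of `s / N - 1` copies of `L`, then `(a_1, …, a_{N-1}, 1 + a_N)`, then
`s % N` zeros. -/
def exclusiveBlock (L : List ℕ) (s : ℕ) : List ℕ :=
  if s < L.length then bump L
  else (List.replicate (s / L.length - 1) L).flatten ++ bump L
    ++ List.replicate (s % L.length) 0

/-- `c` comes directly after `b` in the enumeration `b_1, …, b_ℓ` of `𝓗_s`, that is,
`c ∈ 𝓗_s` and `1 + (b|s) * H = (c|s) * H`. -/
def IsNext (L : List ℕ) (H : ℕ → ℕ) (s : ℕ) (b c : List ℕ) : Prop :=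
  c ∈ leadingBlocks L H s ∧ 1 + conv (b.take s) H = conv (c.take s) H

open Classical in
/-- The block `b̃`: for `b = b_k ∈ 𝓗_s` it is `b_{k+1}`, which is the next member of `𝓗_s` if `b` is
not the largest leading block, and the exclusive block if `b` is the largest one. -/
noncomputable def tilde (L : List ℕ) (H : ℕ → ℕ) (s : ℕ) (b : List ℕ) : List ℕ :=
  if h : ∃ c, IsNext L H s b c then h.choose else exclusiveBlock L s

/-- `Prob {n ∈ ℕ : P(n)} = d`, where `ℕ = {1, 2, 3, …}`: the limit of
`#{k : P(k), 1 ≤ k ≤ n} / n` exists and equals `d`. -/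
def HasProb (P : ℕ → Prop) (d : ℝ) : Prop :=
  Tendsto (fun n : ℕ => (Set.ncard {k : ℕ | P k ∧ 1 ≤ k ∧ k ≤ n} : ℝ) / n) atTop (𝓝 d)

end GenZeckendorf

/-! For tuples of equal length in `𝓗°`, the order of the values `ε * H` is lexicographic. Hence the
integers whose expansion has a given large length `t` and leading block `B` form an interval: it
runs from `B` padded by zeros up to, but excluding, the padded `B̃` (`isLB_iff`). The exclusive
block is built so that its padded value is `H (t + 1)`, the end of the range of length `t`.

The defining property of `H` forces a linear recurrence with coefficients `(a_1, …, a_{N-1}, 1 +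
a_N)`, of which `ψ` is a characteristic root. So `H t / ψ ^ t` is a weighted average of its `N`
predecessors and converges to some `δ > 0` (`exists_tendsto_div_pow`). In logarithms to base `ψ` the
intervals become, up to `o(1)`, the translates by `t` of one interval from `log (δ B·Ĥ)` to `log (δ
B̃·Ĥ)`.

Since `log K_n = log a + n α + o(1)` with `α = log_ψ b`, the event says, up to small errors at the
ends, that `n α` lies in a fixed interval modulo `1`. As `α` is irrational, the limiting frequency
is the length of that interval. The equidistribution used is derived from the density of `ℤα + ℤ`
(`exists_mul_visits_le`), and `hasProb_of_sandwich` absorbs the errors. -/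

namespace GenZeckendorf

/-! ### Tuples of `𝓗°` as words accepted by an automaton -/

/-- Acceptance of a tuple by the automaton with states `0, 1, 2, …`, started in the state `q`: the
entry `c` read in the state `q` leads to `0` if `c < θ q` and to `q + 1` if `c = θ q`. -/
def MemFrom (θ : ℕ → ℕ) : ℕ → List ℕ → Prop
  | _, [] => True
  | q, c :: τ => (c < θ q ∧ MemFrom θ 0 τ) ∨ (c = θ q ∧ MemFrom θ (q + 1) τ)

/-- The tuple `(θ q, θ (q + 1), …)` of length `m`. -/
def segment (θ : ℕ → ℕ) (q m : ℕ) : List ℕ := (List.range m).map fun i => θ (q + i)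

theorem segment_zero_right (θ : ℕ → ℕ) (q : ℕ) : segment θ q 0 = [] := rfl

theorem segment_succ (θ : ℕ → ℕ) (q m : ℕ) :
    segment θ q (m + 1) = θ q :: segment θ (q + 1) m := by
  simp [segment, List.range_succ_eq_map, Function.comp_def, add_assoc, add_comm 1]

theorem length_segment (θ : ℕ → ℕ) (q m : ℕ) : (segment θ q m).length = m := by
  simp [segment]

theorem segment_add (θ : ℕ → ℕ) (q m r : ℕ) :
    segment θ q (m + r) = segment θ q m ++ segment θ (q + m) r := by
  induction m generalizing q with
  | zero => simp [segment_zero_right]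
  | succ m ih =>
    rw [show m + 1 + r = (m + r) + 1 by ring, segment_succ, segment_succ, ih]
    simp [add_assoc, add_comm 1]

theorem thetaTake_eq_segment (L : List ℕ) (s : ℕ) : thetaTake L s = segment (theta L) 0 s := by
  simp [thetaTake, segment]

section conv

variable {H : ℕ → ℕ}

theorem conv_nil : conv [] H = 0 := rfl

theorem conv_cons (c : ℕ) (τ : List ℕ) :
    conv (c :: τ) H = c * H (τ.length + 1) + conv τ H := by
  simp only [conv, List.length_cons, Finset.sum_range_succ', List.getD_cons_succ,
    List.getD_cons_zero, Nat.sub_zero, Nat.add_sub_add_right]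
  ring

theorem conv_replicate_zero (r : ℕ) : conv (List.replicate r 0) H = 0 := by
  induction r with
  | zero => rfl
  | succ r ih => rw [List.replicate_succ, conv_cons, ih]; simp

theorem conv_append (β σ : List ℕ) :
    conv (β ++ σ) H = conv (β ++ List.replicate σ.length 0) H + conv σ H := by
  induction β with
  | nil => simp [conv_replicate_zero]
  | cons c β ih =>
    simp only [List.cons_append, conv_cons, ih, List.length_append, List.length_replicate]
    ring

end conv

section MemFrom

variable {θ : ℕ → ℕ}

theorem memFrom_segment (q m : ℕ) : MemFrom θ q (segment θ q m) := by
  induction m generalizing q with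
  | zero => trivial
  | succ m ih => rw [segment_succ]; exact Or.inr ⟨rfl, ih _⟩

theorem memFrom_segment_append_cons {q s c : ℕ} {τ : List ℕ} (hc : c < θ (q + s))
    (hτ : MemFrom θ 0 τ) : MemFrom θ q (segment θ q s ++ c :: τ) := by
  induction s generalizing q with
  | zero => exact Or.inl ⟨hc, hτ⟩
  | succ s ih =>
    rw [segment_succ]
    exact Or.inr ⟨rfl, ih (by rwa [add_assoc, add_comm 1])⟩

theorem MemFrom.eq_segment_or {q : ℕ} {ε : List ℕ} (h : MemFrom θ q ε) :
    ε = segment θ q ε.length ∨ ∃ s c τ, c < θ (q + s) ∧ MemFrom θ 0 τ ∧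
      ε = segment θ q s ++ c :: τ := by
  induction ε generalizing q with
  | nil => exact Or.inl rfl
  | cons c τ ih =>
    rcases h with ⟨h1, h2⟩ | ⟨h1, h2⟩
    · exact Or.inr ⟨0, c, τ, h1, h2, rfl⟩
    · rcases ih h2 with h | ⟨s, c', τ', h3, h4, h5⟩
      · left; rw [List.length_cons, segment_succ, ← h, h1]
      · refine Or.inr ⟨s + 1, c', τ', by rwa [add_comm s, ← add_assoc], h4, ?_⟩
        rw [segment_succ, h1, h5]; rfl

theorem memCirc_iff_memFrom {L ε : List ℕ} : MemCirc L ε ↔ MemFrom (theta L) 0 ε := by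
  constructor
  · intro h
    induction h with
    | full s => rw [thetaTake_eq_segment]; exact memFrom_segment _ _
    | step s c τ hc _ ih =>
      rw [thetaTake_eq_segment]
      exact memFrom_segment_append_cons (by simpa using hc) ih
  · intro h
    induction hn : ε.length using Nat.strong_induction_on generalizing ε with
    | _ n ih =>
      rcases h.eq_segment_or with h | ⟨s, c, τ, hc, hτ, rfl⟩
      · rw [h, ← thetaTake_eq_segment]; exact MemCirc.full _
      · rw [← thetaTake_eq_segment]
        refine MemCirc.step s c τ (by simpa using hc) (ih _ ?_ hτ rfl)
        rw [← hn]; simp; omega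

theorem MemFrom.of_append {q : ℕ} {ε σ : List ℕ} (h : MemFrom θ q (ε ++ σ)) : MemFrom θ q ε := by
  induction ε generalizing q with
  | nil => trivial
  | cons c ε ih => exact h.imp (fun h => ⟨h.1, ih h.2⟩) (fun h => ⟨h.1, ih h.2⟩)

theorem memFrom_replicate_zero (q r : ℕ) : MemFrom θ q (List.replicate r 0) := by
  induction r generalizing q with
  | zero => trivial
  | succ r ih =>
    rcases Nat.eq_zero_or_pos (θ q) with h | h
    · exact Or.inr ⟨h.symm, ih _⟩
    · exact Or.inl ⟨h, ih _⟩

theorem MemFrom.append_replicate_zero {q : ℕ} {ε : List ℕ} (h : MemFrom θ q ε) (r : ℕ) :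
    MemFrom θ q (ε ++ List.replicate r 0) := by
  induction ε generalizing q with
  | nil => exact memFrom_replicate_zero _ _
  | cons c ε ih => exact h.imp (fun h => ⟨h.1, ih h.2⟩) (fun h => ⟨h.1, ih h.2⟩)

end MemFrom

/-! ### The recursion for `H` and the lexicographic order -/

/-- The terms `H 1, …, H T` satisfy the recursion `H (u + 1) = 1 + θ|u * H`. -/
def RecursionUpTo (θ H : ℕ → ℕ) (T : ℕ) : Prop :=
  ∀ u, u < T → H (u + 1) = 1 + conv (segment θ 0 u) H

section recursion

variable {θ H : ℕ → ℕ} {T : ℕ}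

/-- An entry below `θ q` gives up at least one full `H (τ.length + 1)`, which by the recursion
exceeds everything the restarted tail can contribute. -/
theorem MemFrom.conv_le (hR : RecursionUpTo θ H T) {q : ℕ} {ε : List ℕ} (h : MemFrom θ q ε)
    (hT : ε.length ≤ T) : conv ε H ≤ conv (segment θ q ε.length) H := by
  induction ε generalizing q with
  | nil => rfl
  | cons c τ ih =>
    rw [List.length_cons] at hT
    rw [List.length_cons, segment_succ, conv_cons, conv_cons, length_segment]
    rcases h with ⟨h1, h2⟩ | ⟨h1, h2⟩
    · have h3 := ih h2 (by omega)
      have h4 := hR τ.length (by omega)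
      have h5 : (c + 1) * H (τ.length + 1) ≤ θ q * H (τ.length + 1) :=
        Nat.mul_le_mul_right _ h1
      rw [add_mul] at h5
      omega
    · rw [h1]; exact Nat.add_le_add_left (ih h2 (by omega)) _

theorem MemFrom.conv_lt (hR : RecursionUpTo θ H T) {ε : List ℕ} (h : MemFrom θ 0 ε)
    (hT : ε.length < T) : conv ε H < H (ε.length + 1) := by
  have := h.conv_le hR hT.le
  have := hR _ hT
  omega

/-- Greedy expansion: use the digit `θ q` if it fits; otherwise divide by `H (t + 1)`, and the
remainder is within reach of a tail read from state `0`. -/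
theorem exists_memFrom_of_le (hR : RecursionUpTo θ H T) {t : ℕ} (ht : t ≤ T) {q n : ℕ}
    (hn : n ≤ conv (segment θ q t) H) : ∃ ε, MemFrom θ q ε ∧ ε.length = t ∧ conv ε H = n := by
  induction t generalizing q n with
  | zero =>
    refine ⟨[], trivial, rfl, ?_⟩
    rw [segment_zero_right] at hn
    exact (Nat.le_zero.1 hn).symm
  | succ t ih =>
    rw [segment_succ, conv_cons, length_segment] at hn
    have hr := hR t (by omega)
    rcases le_or_gt (θ q * H (t + 1)) n with h | h
    · obtain ⟨ε, h1, h2, h3⟩ := ih (q := q + 1) (n := n - θ q * H (t + 1)) (by omega) (by omega)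
      refine ⟨θ q :: ε, Or.inr ⟨rfl, h1⟩, by simp [h2], ?_⟩
      rw [conv_cons, h2, h3]; omega
    · have hpos : 0 < H (t + 1) := by omega
      have hmod := Nat.mod_lt n hpos
      obtain ⟨ε, h1, h2, h3⟩ := ih (q := 0) (n := n % H (t + 1)) (by omega) (by omega)
      refine ⟨n / H (t + 1) :: ε, Or.inl ⟨Nat.div_lt_of_lt_mul (by rwa [mul_comm]), h1⟩,
        by simp [h2], ?_⟩
      rw [conv_cons, h2, h3, mul_comm]
      exact Nat.div_add_mod _ _

/-- The smaller digit `x` cannot equal `θ q`, so its tail is read from state `0` and is worth less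
than one unit of the leading place. -/
theorem MemFrom.conv_cons_lt (hR : RecursionUpTo θ H T) {q x y : ℕ} {τ τ' : List ℕ}
    (hx : MemFrom θ q (x :: τ)) (hy : MemFrom θ q (y :: τ')) (hlen : τ.length = τ'.length)
    (hT : τ.length < T) (hxy : x < y) : conv (x :: τ) H < conv (y :: τ') H := by
  have hτ : MemFrom θ 0 τ := by
    rcases hx with h | h
    · exact h.2
    · rcases hy with h' | h' <;> omega
  have h1 := hτ.conv_lt hR hT
  have h2 : (x + 1) * H (τ.length + 1) ≤ y * H (τ.length + 1) := Nat.mul_le_mul_right _ hxy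
  rw [add_mul] at h2
  rw [conv_cons, conv_cons, ← hlen]
  omega

theorem MemFrom.of_cons_same {q x : ℕ} {τ τ' : List ℕ}
    (hx : MemFrom θ q (x :: τ)) (hy : MemFrom θ q (x :: τ')) :
    ∃ q', MemFrom θ q' τ ∧ MemFrom θ q' τ' := by
  rcases hx with h | h
  · rcases hy with h' | h'
    · exact ⟨0, h.2, h'.2⟩
    · omega
  · rcases hy with h' | h'
    · omega
    · exact ⟨q + 1, h.2, h'.2⟩

/-- The first differing digit decides both comparisons, so the order of the prefixes survives any
admissible continuation. -/
theorem MemFrom.conv_append_lt (hR : RecursionUpTo θ H T) {q : ℕ} {κ β σ τ : List ℕ}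
    (hκ : MemFrom θ q (κ ++ σ)) (hβ : MemFrom θ q (β ++ τ)) (hlen : κ.length = β.length)
    (hlen' : σ.length = τ.length) (hT : (κ ++ σ).length ≤ T) (hlt : conv κ H < conv β H) :
    conv (κ ++ σ) H < conv (β ++ τ) H := by
  induction κ generalizing q β with
  | nil =>
    rw [List.length_nil] at hlen
    rw [List.length_eq_zero_iff.1 hlen.symm] at hlt
    exact absurd hlt (lt_irrefl _)
  | cons x κ ih =>
    rcases β with _ | ⟨y, β⟩
    · simp at hlen
    simp only [List.length_cons, List.cons_append, List.length_append, add_left_inj] at *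
    rcases lt_trichotomy x y with h | rfl | h
    · exact hκ.conv_cons_lt hR hβ (by simp [hlen, hlen']) (by simp; omega) h
    · obtain ⟨q', h1, h2⟩ := hκ.of_cons_same hβ
      have := ih h1 h2 hlen (by omega) (by
        rw [conv_cons, conv_cons, hlen] at hlt; omega)
      rw [conv_cons, conv_cons, List.length_append, List.length_append, hlen, hlen']
      omega
    · have h1 : MemFrom θ q (x :: κ) := MemFrom.of_append (σ := σ) hκ
      have h2 : MemFrom θ q (y :: β) := MemFrom.of_append (σ := τ) hβ
      exact absurd (h2.conv_cons_lt hR h1 hlen.symm (by omega) h) (by omega)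

end recursion

theorem mem_collection_iff {L ε : List ℕ} :
    ε ∈ collection L ↔ MemFrom (theta L) 0 ε ∧ 0 < ε.getD 0 0 := by
  rw [← memCirc_iff_memFrom]; rfl

theorem le_conv_of_pos {H : ℕ → ℕ} {ε : List ℕ} (h : 0 < ε.getD 0 0) :
    H ε.length ≤ conv ε H := by
  rcases ε with _ | ⟨c, τ⟩
  · simp at h
  · rw [conv_cons, List.length_cons]
    exact (Nat.le_mul_of_pos_left _ (by simpa using h)).trans (Nat.le_add_right _ _)

/-- Removing the leading zeros of a tuple in `𝓗°`. -/
theorem MemFrom.exists_collection {L : List ℕ} {H : ℕ → ℕ} (ha : 0 < theta L 0) {ε : List ℕ}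
    (h : MemFrom (theta L) 0 ε) (hpos : 0 < conv ε H) :
    ∃ ε' ∈ collection L, ε'.length ≤ ε.length ∧ conv ε' H = conv ε H := by
  induction ε with
  | nil => simp [conv_nil] at hpos
  | cons c τ ih =>
    rcases Nat.eq_zero_or_pos c with rfl | hc
    · have hτ : MemFrom (theta L) 0 τ := by
        rcases h with h | h
        · exact h.2
        · omega
      have e : conv (0 :: τ) H = conv τ H := by rw [conv_cons]; simp
      rw [e] at hpos ⊢
      obtain ⟨ε', h1, h2, h3⟩ := ih hτ hpos
      exact ⟨ε', h1, h2.trans (by simp), h3⟩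
    · exact ⟨c :: τ, mem_collection_iff.2 ⟨h, by simpa using hc⟩, le_rfl, rfl⟩

/-- Given the recursion up to `u`, words of length at most `u` reach exactly the values up to `θ|u *
H`. The next integer therefore needs a longer expansion, which bounds `H (u + 1)` above by it. If `H
(u + 1)` were smaller, it would have a short expansion besides `(1, 0, …, 0)`, against uniqueness.
-/
theorem IsFundamentalSequence.recursion {L : List ℕ} {H : ℕ → ℕ} (ha : 0 < theta L 0)
    (hH : IsFundamentalSequence (collection L) H) (T : ℕ) : RecursionUpTo (theta L) H T := by
  obtain ⟨hpos, hmono, huniq⟩ := hH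
  induction T with
  | zero => intro u hu; omega
  | succ t ih =>
    intro u hu
    rcases Nat.lt_succ_iff_lt_or_eq.1 hu with hu | rfl
    · exact ih u hu
    refine le_antisymm ?_ ?_
    · obtain ⟨ε, ⟨hε, hε'⟩, -⟩ := huniq (1 + conv (segment (theta L) 0 u) H) (by omega)
      rw [mem_collection_iff] at hε
      rw [← hε']
      by_cases hl : ε.length ≤ u
      · exfalso
        have h1 := hε.1.conv_le ih hl
        have h2 : conv (segment (theta L) 0 ε.length) H ≤ conv (segment (theta L) 0 u) H := by
          rcases hl.lt_or_eq with hl' | hl'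
          · have h3 := ih _ hl'
            have h4 : 0 < (segment (theta L) 0 u).getD 0 0 := by
              rcases u with _ | u
              · omega
              · rw [segment_succ]; simpa using ha
            have h5 := le_conv_of_pos (H := H) h4
            rw [length_segment] at h5
            have h6 : H (ε.length + 1) ≤ H u :=
              hmono.monotoneOn (Set.mem_Ici.2 (by omega)) (Set.mem_Ici.2 (by omega)) hl'
            omega
          · rw [hl']
        omega
      · exact (hmono.monotoneOn (Set.mem_Ici.2 (by omega)) (Set.mem_Ici.2 (by omega))
          (by omega)).trans (le_conv_of_pos hε.2)
    · by_contra hlt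
      obtain ⟨ε, h1, h2, h3⟩ := exists_memFrom_of_le ih le_rfl (q := 0) (n := H (u + 1)) (by omega)
      obtain ⟨ε', h4, h5, h6⟩ := h1.exists_collection (H := H) ha
        (by rw [h3]; exact hpos _ (by omega))
      have h7 : (1 :: List.replicate u 0) ∈ collection L := by
        refine mem_collection_iff.2 ⟨?_, by simp⟩
        rcases Nat.lt_or_eq_of_le (Nat.succ_le_of_lt ha) with h | h
        · exact Or.inl ⟨h, memFrom_replicate_zero _ _⟩
        · exact Or.inr ⟨h, memFrom_replicate_zero _ _⟩
      have h8 : conv (1 :: List.replicate u 0) H = H (u + 1) := by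
        rw [conv_cons, conv_replicate_zero]; simp
      have h9 := (huniq _ (hpos (u + 1) (by omega))).unique ⟨h4, h6.trans h3⟩ ⟨h7, h8⟩
      rw [h9] at h5
      simp at h5
      omega

/-! ### Zero-padded blocks, the linear recurrence and the exclusive block -/

/-- The product `(b, 0, …, 0) * H`, where the tuple `b` is padded by zeros to length `t`. -/
def convAt (b : List ℕ) (H : ℕ → ℕ) (t : ℕ) : ℕ := conv (b ++ List.replicate (t - b.length) 0) H

theorem convAt_append_replicate_zero {b : List ℕ} {H : ℕ → ℕ} {r t : ℕ} (h : b.length + r ≤ t) :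
    convAt (b ++ List.replicate r 0) H t = convAt b H t := by
  rw [convAt, convAt, List.append_assoc, List.replicate_append_replicate, List.length_append,
    List.length_replicate]
  congr 3
  omega

theorem convAt_eq_sum {b : List ℕ} {H : ℕ → ℕ} {t : ℕ} (h : b.length ≤ t) :
    convAt b H t = ∑ i ∈ Finset.range b.length, b.getD i 0 * H (t - i) := by
  induction b generalizing t with
  | nil => simp [convAt, conv_replicate_zero]
  | cons c b ih =>
    obtain ⟨t, rfl⟩ : ∃ u, t = u + 1 := ⟨t - 1, by simp at h; omega⟩
    have h' : b.length ≤ t := by simpa using h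
    rw [List.length_cons, Finset.sum_range_succ', convAt, List.cons_append, conv_cons]
    simp only [List.getD_cons_succ, List.getD_cons_zero, Nat.add_sub_add_right, Nat.sub_zero,
      List.length_append, List.length_replicate, List.length_cons]
    rw [← ih h', convAt, Nat.add_sub_cancel' h', add_comm]

section recurrence

variable {L : List ℕ} {H : ℕ → ℕ}

theorem theta_add_length (L : List ℕ) (i : ℕ) : theta L (L.length + i) = theta L i := by
  simp [theta]

theorem segment_theta_length (L : List ℕ) : segment (theta L) 0 L.length = L := by
  refine List.ext_getElem (length_segment _ _ _) fun i h1 h2 => ?_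
  simp [segment, theta, Nat.mod_eq_of_lt h2, h2]

theorem segment_theta_add (L : List ℕ) (r : ℕ) :
    segment (theta L) 0 (L.length + r) = L ++ segment (theta L) 0 r := by
  rw [segment_add, segment_theta_length]
  congr 1
  simp [segment, theta_add_length]

theorem length_bump (hL : L ≠ []) : (bump L).length = L.length := by
  have := List.length_pos_of_ne_nil hL
  simp [bump]; omega

theorem conv_bump_append (hL : L ≠ []) (σ : List ℕ) :
    conv (bump L ++ σ) H = conv (L ++ σ) H + H (σ.length + 1) := by
  obtain ⟨M, x, rfl⟩ := List.eq_nil_or_concat L |>.resolve_left hL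
  have e : bump (M ++ [x]) = M ++ [1 + x] := by simp [bump]
  rw [List.concat_eq_append, e, List.append_assoc, List.append_assoc, conv_append,
    conv_append M ([x] ++ σ)]
  simp only [List.cons_append, List.nil_append, conv_cons, List.length_cons]
  ring

/-- By periodicity `Θ|(N + r)` is `L` followed by `Θ|r`; subtracting the recursion at `r` from the
one at `N + r` cancels the tail. -/
theorem conv_append_replicate_add (hR : ∀ t, RecursionUpTo (theta L) H t) (r : ℕ) :
    conv (L ++ List.replicate r 0) H + H (r + 1) = H (L.length + r + 1) := by
  rw [hR _ _ (Nat.lt_succ_self (L.length + r)), hR _ _ (Nat.lt_succ_self r), segment_theta_add,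
    conv_append L (segment _ _ _), length_segment]
  ring

theorem convAt_bump (hL : L ≠ []) (hR : ∀ t, RecursionUpTo (theta L) H t) {t : ℕ}
    (ht : L.length ≤ t) : convAt (bump L) H t = H (t + 1) := by
  rw [convAt, conv_bump_append hL, List.length_replicate, conv_append_replicate_add hR,
    length_bump hL, Nat.add_sub_cancel' ht]

/-- The carry propagates: the tail is worth a single `H` term, and the copy of `L` in front of it
absorbs this term into a later one. -/
theorem conv_flatten_append_bump (hL : L ≠ []) (hR : ∀ t, RecursionUpTo (theta L) H t)
    (k r : ℕ) : conv ((List.replicate k L).flatten ++ bump L ++ List.replicate r 0) H =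
      H ((k + 1) * L.length + r + 1) := by
  induction k with
  | zero =>
    have h := convAt_bump hL hR (Nat.le_add_right L.length r)
    rw [convAt, length_bump hL, Nat.add_sub_cancel_left] at h
    simpa using h
  | succ k ih =>
    rw [List.replicate_succ, List.flatten_cons, List.append_assoc, List.append_assoc, conv_append,
      ← List.append_assoc, ih]
    have e : ((List.replicate k L).flatten ++ bump L ++ List.replicate r 0).length =
        (k + 1) * L.length + r := by
      simp [length_bump hL]; ring
    rw [e, conv_append_replicate_add hR]
    congr 1
    ring

theorem length_exclusiveBlock (hL : L ≠ []) (s : ℕ) :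
    (exclusiveBlock L s).length = max s L.length := by
  unfold exclusiveBlock
  split_ifs with h
  · rw [length_bump hL]; omega
  · have hp := List.length_pos_of_ne_nil hL
    have h1 : 1 ≤ s / L.length := Nat.div_pos (not_lt.1 h) hp
    have h2 := Nat.div_add_mod s L.length
    obtain ⟨q, hq⟩ : ∃ q, s / L.length = q + 1 := ⟨_, (Nat.sub_add_cancel h1).symm⟩
    rw [hq] at h2 ⊢
    simp [length_bump hL]
    nlinarith [max_eq_left (not_lt.1 h)]

theorem convAt_exclusiveBlock (hL : L ≠ []) (hR : ∀ t, RecursionUpTo (theta L) H t) {s t : ℕ}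
    (ht : max s L.length ≤ t) : convAt (exclusiveBlock L s) H t = H (t + 1) := by
  have hlen := length_exclusiveBlock hL s
  unfold exclusiveBlock at hlen ⊢
  split_ifs with h
  · exact convAt_bump hL hR ((le_max_right _ _).trans ht)
  · rw [if_neg h] at hlen
    have hp := List.length_pos_of_ne_nil hL
    have h1 : 1 ≤ s / L.length := Nat.div_pos (not_lt.1 h) hp
    have h2 := Nat.div_add_mod s L.length
    rw [convAt, hlen, List.append_assoc, List.replicate_append_replicate,
      conv_flatten_append_bump hL hR, Nat.sub_add_cancel h1, mul_comm]
    congr 1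
    omega

end recurrence

/-! ### Leading blocks and their successors -/

section leadingBlocks

variable {L : List ℕ} {H : ℕ → ℕ}

theorem take_mem_collection {ε : List ℕ} (h : ε ∈ collection L) {s : ℕ} (hs : 1 ≤ s) :
    ε.take s ∈ collection L := by
  rw [mem_collection_iff] at h ⊢
  refine ⟨MemFrom.of_append (σ := ε.drop s) (by rw [List.take_append_drop]; exact h.1), ?_⟩
  obtain ⟨s, rfl⟩ : ∃ u, s = u + 1 := ⟨s - 1, by omega⟩
  rcases ε with _ | ⟨c, τ⟩
  · simpa using h.2
  · simpa using h.2

theorem append_replicate_zero_mem_collection {ε : List ℕ} (h : ε ∈ collection L) (r : ℕ) :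
    ε ++ List.replicate r 0 ∈ collection L := by
  rw [mem_collection_iff] at h ⊢
  refine ⟨h.1.append_replicate_zero r, ?_⟩
  rcases ε with _ | ⟨c, τ⟩
  · simpa using h.2
  · simpa using h.2

/-- Unifies the cases `s < N` and `s ≥ N`: in the latter the padding is empty. -/
theorem mem_leadingBlocks_iff (hpos : ∀ n, 1 ≤ n → 0 < H n) {s : ℕ} (hs : 1 ≤ s) {b : List ℕ} :
    b ∈ leadingBlocks L H s ↔ ∃ β ∈ collection L, β.length = s ∧
      b = β ++ List.replicate (L.length - s) 0 := by
  constructor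
  · rintro ⟨⟨n, -, ε, hε, -, hlen, hb⟩, hz⟩
    have hb' : b = ε.take (max s L.length) := by
      rw [hb, Nat.sub_eq_zero_of_le (le_max_right s L.length)]; simp
    refine ⟨ε.take s, take_mem_collection hε hs, by simp; omega, ?_⟩
    have h1 : b.take s = ε.take s := by rw [hb', List.take_take]; congr 1; omega
    rw [← h1]
    conv_lhs => rw [← List.take_append_drop s b]
    congr 1
    refine List.eq_replicate_iff.2 ⟨by rw [hb']; simp; omega, fun x hx => ?_⟩
    obtain ⟨i, hi, rfl⟩ := List.getElem_of_mem hx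
    have h2 := hz (s + i) (Nat.le_add_right _ _)
    rw [List.getD_eq_getElem _ _ (by simp at hi; omega)] at h2
    simpa using h2
  · rintro ⟨β, hβ, hlen, rfl⟩
    have hc := append_replicate_zero_mem_collection hβ (L.length - s)
    have hl : (β ++ List.replicate (L.length - s) 0).length = max s L.length := by
      simp [hlen]; omega
    refine ⟨⟨conv (β ++ List.replicate (L.length - s) 0) H, ?_, _, hc, rfl, hl.ge, ?_⟩, ?_⟩
    · refine (hpos _ ?_).trans_le (le_conv_of_pos hc.2)
      rw [hl]; omega
    · rw [Nat.sub_eq_zero_of_le (le_max_right s L.length), List.take_of_length_le hl.le]; simp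
    · intro j hj
      rw [List.getD_append_right _ _ _ _ (by omega)]
      simp [List.getD_eq_getElem?_getD, List.getElem?_replicate]
      split_ifs <;> rfl

theorem tilde_cases (hpos : ∀ n, 1 ≤ n → 0 < H n) {s : ℕ} (hs : 1 ≤ s) {β : List ℕ}
    (hlen : β.length = s) :
    (∃ γ ∈ collection L, γ.length = s ∧ conv γ H = 1 + conv β H ∧
        tilde L H s (β ++ List.replicate (L.length - s) 0) =
          γ ++ List.replicate (L.length - s) 0) ∨
      ((∀ γ ∈ collection L, γ.length = s → conv γ H ≠ 1 + conv β H) ∧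
        tilde L H s (β ++ List.replicate (L.length - s) 0) = exclusiveBlock L s) := by
  have htake : ∀ γ : List ℕ, γ.length = s →
      (γ ++ List.replicate (L.length - s) 0).take s = γ := fun γ h => by
    rw [← h, List.take_left]
  unfold tilde
  split_ifs with h
  · left
    obtain ⟨h1, h2⟩ := h.choose_spec
    obtain ⟨γ, h3, h4, h5⟩ := (mem_leadingBlocks_iff hpos hs).1 h1
    rw [h5, htake _ h4, htake _ hlen] at h2
    exact ⟨γ, h3, h4, h2.symm, h5⟩
  · right
    refine ⟨fun γ h1 h2 h3 => h ⟨γ ++ List.replicate (L.length - s) 0, ?_, ?_⟩, rfl⟩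
    · exact (mem_leadingBlocks_iff hpos hs).2 ⟨γ, h1, h2, rfl⟩
    · rw [htake _ h2, htake _ hlen, h3]

end leadingBlocks

/-! ### Integers with a given leading block form intervals -/

section intervals

variable {L : List ℕ} {H : ℕ → ℕ}

theorem conv_lt_of_mem_collection (hR : ∀ t, RecursionUpTo (theta L) H t) {ε : List ℕ}
    (hε : ε ∈ collection L) : conv ε H < H (ε.length + 1) :=
  (mem_collection_iff.1 hε).1.conv_lt (hR _) (Nat.lt_succ_self _)

theorem length_eq_of_conv_mem (hR : ∀ t, RecursionUpTo (theta L) H t)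
    (hmono : StrictMonoOn H (Set.Ici 1)) {ε : List ℕ} (hε : ε ∈ collection L) {t : ℕ}
    (ht : 1 ≤ t) (h1 : H t ≤ conv ε H) (h2 : conv ε H < H (t + 1)) : ε.length = t := by
  have h3 := conv_lt_of_mem_collection hR hε
  have h4 := le_conv_of_pos (H := H) hε.2
  have h5 : 1 ≤ ε.length := by
    by_contra h
    have := hε.2
    rw [List.length_eq_zero_iff.1 (show ε.length = 0 by omega)] at this
    simp at this
  have h6 := (hmono.lt_iff_lt (Set.mem_Ici.2 ht)
    (Set.mem_Ici.2 (Nat.le_add_left 1 _))).1 (h1.trans_lt h3)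
  have h7 := (hmono.lt_iff_lt (Set.mem_Ici.2 h5)
    (Set.mem_Ici.2 (Nat.le_add_left 1 _))).1 (h4.trans_lt h2)
  omega

theorem le_convAt_of_mem_collection {β : List ℕ} (hβ : β ∈ collection L) {t : ℕ}
    (ht : β.length ≤ t) : H t ≤ convAt β H t := by
  have h := le_conv_of_pos (H := H)
    (append_replicate_zero_mem_collection hβ (t - β.length)).2
  rwa [List.length_append, List.length_replicate, Nat.add_sub_cancel' ht] at h

theorem convAt_lt_of_mem_collection (hR : ∀ t, RecursionUpTo (theta L) H t) {β : List ℕ}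
    (hβ : β ∈ collection L) {t : ℕ} (ht : β.length ≤ t) : convAt β H t < H (t + 1) := by
  have h := conv_lt_of_mem_collection hR
    (append_replicate_zero_mem_collection hβ (t - β.length))
  rwa [List.length_append, List.length_replicate, Nat.add_sub_cancel' ht] at h

theorem conv_lt_convAt (hR : ∀ t, RecursionUpTo (theta L) H t) {ε γ : List ℕ}
    (hε : ε ∈ collection L) (hγ : γ ∈ collection L) (hlen : γ.length ≤ ε.length)
    (h : conv (ε.take γ.length) H < conv γ H) : conv ε H < convAt γ H ε.length := by
  have h1 := append_replicate_zero_mem_collection hγ (ε.length - γ.length)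
  rw [mem_collection_iff] at h1 hε
  have h2 := MemFrom.conv_append_lt (hR _) (κ := ε.take γ.length) (σ := ε.drop γ.length)
    (by rw [List.take_append_drop]; exact hε.1) h1.1 (by simpa using hlen) (by simp) le_rfl h
  rwa [List.take_append_drop] at h2

theorem convAt_le_conv (hR : ∀ t, RecursionUpTo (theta L) H t)
    (huniq : ∀ n, 1 ≤ n → ∃! ε, ε ∈ collection L ∧ conv ε H = n)
    (hpos : ∀ n, 1 ≤ n → 0 < H n) {ε γ : List ℕ}
    (hε : ε ∈ collection L) (hγ : γ ∈ collection L) (hγ1 : 1 ≤ γ.length)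
    (hlen : γ.length ≤ ε.length) (h : conv γ H ≤ conv (ε.take γ.length) H) :
    convAt γ H ε.length ≤ conv ε H := by
  have hpre := take_mem_collection hε hγ1
  rcases h.lt_or_eq with h | h
  · have h1 := append_replicate_zero_mem_collection hγ (ε.length - γ.length)
    rw [mem_collection_iff] at h1 hε
    have h2 := MemFrom.conv_append_lt (hR _) h1.1 (κ := γ) (β := ε.take γ.length)
      (τ := ε.drop γ.length)
      (by rw [List.take_append_drop]; exact hε.1) (by simpa using hlen) (by simp) le_rfl h
    rw [List.take_append_drop] at h2
    exact h2.le
  -- Equal values force equal prefixes by uniqueness, and the remaining digits of `ε` only add to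
  -- the value.
  · have e : γ = ε.take γ.length :=
      (huniq _ ((hpos _ hγ1).trans_le (le_conv_of_pos hγ.2))).unique ⟨hγ, rfl⟩ ⟨hpre, h.symm⟩
    have h2 := conv_append (H := H) (ε.take γ.length) (ε.drop γ.length)
    rw [List.take_append_drop, List.length_drop, ← e] at h2
    rw [convAt]
    omega

theorem convAt_tilde_bounds (hL : L ≠ []) (hH : IsFundamentalSequence (collection L) H)
    (hR : ∀ t, RecursionUpTo (theta L) H t) {s : ℕ} (hs : 1 ≤ s) {B : List ℕ}
    (hB : B ∈ leadingBlocks L H s) {t : ℕ} (ht : max s L.length ≤ t) :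
    H t ≤ convAt B H t ∧ convAt B H t ≤ convAt (tilde L H s B) H t ∧
      convAt (tilde L H s B) H t ≤ H (t + 1) := by
  obtain ⟨hpos, hmono, huniq⟩ := hH
  obtain ⟨β, hβ, hlen, rfl⟩ := (mem_leadingBlocks_iff hpos hs).1 hB
  have hst : s ≤ t := (le_max_left _ _).trans ht
  have hpad : ∀ γ : List ℕ, γ.length = s →
      convAt (γ ++ List.replicate (L.length - s) 0) H t = convAt γ H t := fun γ h =>
    convAt_append_replicate_zero (by omega)
  rw [hpad β hlen]
  refine ⟨le_convAt_of_mem_collection hβ (by omega), ?_⟩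
  rcases tilde_cases hpos hs hlen with ⟨γ, hγ, hγl, hγc, e⟩ | ⟨-, e⟩
  · rw [e, hpad γ hγl]
    refine ⟨?_, (convAt_lt_of_mem_collection hR hγ (by omega)).le⟩
    have h := conv_lt_convAt hR (append_replicate_zero_mem_collection hβ (t - β.length)) hγ
      (by simp; omega) (by rw [hγl, ← hlen, List.take_left]; omega)
    rw [List.length_append, List.length_replicate, hlen, Nat.add_sub_cancel' hst] at h
    rw [convAt, hlen]
    exact h.le
  · rw [e, convAt_exclusiveBlock hL hR ht]
    exact ⟨(convAt_lt_of_mem_collection hR hβ (by omega)).le, le_rfl⟩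

/-- A prefix of value above that of `β` has at least the value of the successor, which pushes the
whole number past the right endpoint. The threshold `T` leaves only lengths at which all the padded
blocks fit. -/
theorem isLB_iff (hL : L ≠ []) (hH : IsFundamentalSequence (collection L) H)
    (hR : ∀ t, RecursionUpTo (theta L) H t) {s : ℕ} (hs : 1 ≤ s) {B : List ℕ}
    (hB : B ∈ leadingBlocks L H s) {T m : ℕ} (hT : max s L.length ≤ T) (hm : H T ≤ m) :
    IsLB L H s m B ↔ ∃ t, T ≤ t ∧ convAt B H t ≤ m ∧ m < convAt (tilde L H s B) H t := by
  have hbounds := fun t (ht : T ≤ t) =>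
    convAt_tilde_bounds hL hH hR hs hB (hT.trans ht)
  obtain ⟨hpos, hmono, huniq⟩ := hH
  have hsT : s ≤ T := (le_max_left _ _).trans hT
  obtain ⟨β, hβ, hlen, rfl⟩ := (mem_leadingBlocks_iff hpos hs).1 hB
  have hpad : ∀ γ : List ℕ, γ.length = s → ∀ t, T ≤ t →
      convAt (γ ++ List.replicate (L.length - s) 0) H t = convAt γ H t := fun γ h t ht =>
    convAt_append_replicate_zero (by omega)
  constructor
  · rintro ⟨ε, hε, rfl, hsε, hb⟩
    have hpre : β = ε.take s := by
      have := congrArg (List.take s) hb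
      rwa [← hlen, List.take_left, List.take_append_of_le_length (by simp; omega), List.take_take,
        min_self, hlen] at this
    have hTε : T ≤ ε.length := by
      have h1 := conv_lt_of_mem_collection hR hε
      have h2 := (hmono.lt_iff_lt (Set.mem_Ici.2 (hs.trans hsT))
        (Set.mem_Ici.2 (Nat.le_add_left 1 _))).1 (hm.trans_lt h1)
      omega
    refine ⟨ε.length, hTε, ?_, ?_⟩
    · rw [hpad β hlen _ hTε]
      exact convAt_le_conv hR huniq hpos hε hβ (by omega) (by omega) (by rw [hlen, ← hpre])
    · rcases tilde_cases hpos hs hlen with ⟨γ, hγ, hγl, hγc, e⟩ | ⟨-, e⟩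
      · rw [e, hpad γ hγl _ hTε]
        exact conv_lt_convAt hR hε hγ (by omega) (by rw [hγl, ← hpre]; omega)
      · rw [e, convAt_exclusiveBlock hL hR (hT.trans hTε)]
        exact conv_lt_of_mem_collection hR hε
  · rintro ⟨t, hTt, h1, h2⟩
    obtain ⟨hb1, -, hb3⟩ := hbounds t hTt
    obtain ⟨ε, ⟨hε, rfl⟩, -⟩ := huniq m ((hpos T (by omega)).trans_le hm)
    obtain rfl := length_eq_of_conv_mem hR hmono hε (by omega) (hb1.trans h1) (h2.trans_le hb3)
    rw [hpad β hlen _ hTt] at h1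
    have hpre := take_mem_collection hε hs
    have hsε : s ≤ ε.length := by omega
    have hpl : (ε.take s).length = s := by simpa using hsε
    refine ⟨ε, hε, rfl, hsε, ?_⟩
    congr 1
    have hge : conv β H ≤ conv (ε.take s) H := by
      by_contra! h
      exact absurd (conv_lt_convAt hR hε hβ (by omega) (by rwa [hlen])) (not_lt.2 h1)
    have hβpos : H s ≤ conv β H := by
      have := le_conv_of_pos (H := H) hβ.2
      rwa [hlen] at this
    rcases hge.lt_or_eq with hlt | heq
    · exfalso
      rcases tilde_cases hpos hs hlen with ⟨γ, hγ, hγl, hγc, e⟩ | ⟨hno, -⟩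
      · rw [e, hpad γ hγl _ hTt] at h2
        exact absurd (convAt_le_conv hR huniq hpos hε hγ (by omega) (by omega)
          (by rw [hγl]; omega)) (not_le.2 h2)
      -- Here `1 + conv β H` is at most the value of the prefix, hence below `H (s + 1)`; its
      -- expansion has length `s` and would be a successor.
      · obtain ⟨γ, ⟨hγ, hγc⟩, -⟩ := huniq (1 + conv β H) (by omega)
        have h3 := conv_lt_of_mem_collection hR hpre
        rw [hpl] at h3
        exact hno γ hγ (length_eq_of_conv_mem hR hmono hγ hs (by omega) (by omega)) hγc
    · exact (huniq _ ((hpos s hs).trans_le hβpos)).unique ⟨hβ, rfl⟩ ⟨hpre, heq.symm⟩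

end intervals

/-! ### Convergence of sequences given by averaging recursions -/

section averaging

variable {N : ℕ} {w h : ℕ → ℝ}

theorem bounds_of_window (hw : ∀ i < N, 0 ≤ w i) (hsum : ∑ i ∈ Finset.range N, w i = 1)
    (hrec : ∀ n, h (n + N) = ∑ i ∈ Finset.range N, w i * h (n + N - 1 - i)) {n : ℕ} {m M : ℝ}
    (hwin : ∀ j < N, m ≤ h (n + j) ∧ h (n + j) ≤ M) (k : ℕ) :
    m ≤ h (n + k) ∧ h (n + k) ≤ M := by
  induction k using Nat.strong_induction_on with
  | _ k ih =>
    rcases lt_or_ge k N with hk | hk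
    · exact hwin k hk
    · obtain ⟨r, rfl⟩ := Nat.exists_eq_add_of_le' hk
      have hb : ∀ i ∈ Finset.range N, m ≤ h (n + r + N - 1 - i) ∧ h (n + r + N - 1 - i) ≤ M := by
        intro i hi
        rw [Finset.mem_range] at hi
        have := ih (r + N - 1 - i) (by omega)
        rwa [show n + (r + N - 1 - i) = n + r + N - 1 - i by omega] at this
      rw [← add_assoc, hrec]
      constructor
      · calc m = ∑ i ∈ Finset.range N, w i * m := by rw [← Finset.sum_mul, hsum, one_mul]
          _ ≤ _ := Finset.sum_le_sum fun i hi =>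
            mul_le_mul_of_nonneg_left (hb i hi).1 (hw i (Finset.mem_range.1 hi))
      · calc _ ≤ ∑ i ∈ Finset.range N, w i * M := Finset.sum_le_sum fun i hi =>
            mul_le_mul_of_nonneg_left (hb i hi).2 (hw i (Finset.mem_range.1 hi))
          _ = M := by rw [← Finset.sum_mul, hsum, one_mul]

theorem step_bounds (hN : 0 < N) (hw : ∀ i < N, 0 ≤ w i)
    (hsum : ∑ i ∈ Finset.range N, w i = 1)
    (hrec : ∀ n, h (n + N) = ∑ i ∈ Finset.range N, w i * h (n + N - 1 - i)) {n : ℕ} {m M : ℝ}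
    (hb : ∀ k, m ≤ h (n + k) ∧ h (n + k) ≤ M) :
    m + w 0 * (h (n + N - 1) - m) ≤ h (n + N) ∧
      h (n + N) ≤ M - w 0 * (M - h (n + N - 1)) := by
  obtain ⟨N, rfl⟩ : ∃ u, N = u + 1 := ⟨N - 1, by omega⟩
  have hb' : ∀ i ∈ Finset.range N, m ≤ h (n + (N + 1) - 1 - (i + 1)) ∧
      h (n + (N + 1) - 1 - (i + 1)) ≤ M := by
    intro i hi
    rw [Finset.mem_range] at hi
    have := hb (N - (i + 1))
    rwa [show n + (N - (i + 1)) = n + (N + 1) - 1 - (i + 1) by omega] at this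
  have hw' : ∀ i ∈ Finset.range N, 0 ≤ w (i + 1) := fun i hi =>
    hw _ (by rw [Finset.mem_range] at hi; omega)
  have h1 : ∑ i ∈ Finset.range N, w (i + 1) * m ≤
      ∑ i ∈ Finset.range N, w (i + 1) * h (n + (N + 1) - 1 - (i + 1)) :=
    Finset.sum_le_sum fun i hi => mul_le_mul_of_nonneg_left (hb' i hi).1 (hw' i hi)
  have h2 : ∑ i ∈ Finset.range N, w (i + 1) * h (n + (N + 1) - 1 - (i + 1)) ≤
      ∑ i ∈ Finset.range N, w (i + 1) * M :=
    Finset.sum_le_sum fun i hi => mul_le_mul_of_nonneg_left (hb' i hi).2 (hw' i hi)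
  rw [Finset.sum_range_succ'] at hsum
  rw [← Finset.sum_mul, eq_sub_of_add_eq hsum] at h1 h2
  rw [hrec, Finset.sum_range_succ', Nat.sub_zero]
  constructor <;> linarith

/-- The value `x` just before the new terms enters each next term with weight `w 0` through its
predecessor. Its influence on the `j`-th later term is at least `w 0 ^ j`, so a full window of `N`
terms moves away from both bounds, and all later terms inherit the narrower range. -/
theorem contract_bounds (hN : 0 < N) (hw : ∀ i < N, 0 ≤ w i)
    (hsum : ∑ i ∈ Finset.range N, w i = 1)
    (hrec : ∀ n, h (n + N) = ∑ i ∈ Finset.range N, w i * h (n + N - 1 - i)) {n : ℕ} {m M : ℝ}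
    (hb : ∀ k, m ≤ h (n + k) ∧ h (n + k) ≤ M) :
    ∃ n' m' M', M' - m' = (1 - w 0 ^ N) * (M - m) ∧
      ∀ k, m' ≤ h (n' + k) ∧ h (n' + k) ≤ M' := by
  have hw0 : 0 ≤ w 0 := hw 0 hN
  have hw1 : w 0 ≤ 1 := by
    rw [← hsum]
    exact Finset.single_le_sum (f := w) (fun i hi => hw i (Finset.mem_range.1 hi))
      (Finset.mem_range.2 hN)
  set x := h (n + N - 1) with hx
  have hxb : m ≤ x ∧ x ≤ M := by
    have := hb (N - 1)
    rwa [← Nat.add_sub_assoc hN] at this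
  have hstep : ∀ j, m + w 0 ^ j * (x - m) ≤ h (n + N - 1 + j) ∧
      h (n + N - 1 + j) ≤ M - w 0 ^ j * (M - x) := by
    intro j
    induction j with
    | zero => simp [hx]
    | succ j ih =>
      have := step_bounds (n := n + j) hN hw hsum hrec (m := m) (M := M) fun k => by
        rw [add_assoc]; exact hb _
      rw [show n + j + N - 1 = n + N - 1 + j by omega,
        show n + j + N = n + N - 1 + (j + 1) by omega] at this
      rw [pow_succ]
      have h1 := mul_le_mul_of_nonneg_left ih.1 hw0
      have h2 := mul_le_mul_of_nonneg_left ih.2 hw0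
      constructor <;> linarith
  refine ⟨n + N - 1, m + w 0 ^ N * (x - m), M - w 0 ^ N * (M - x), by ring,
    bounds_of_window hw hsum hrec fun j hj => ?_⟩
  have hp : w 0 ^ N ≤ w 0 ^ j := pow_le_pow_of_le_one hw0 hw1 hj.le
  have h1 := mul_le_mul_of_nonneg_right hp (sub_nonneg.2 hxb.1)
  have h2 := mul_le_mul_of_nonneg_right hp (sub_nonneg.2 hxb.2)
  have h3 := hstep j
  constructor <;> linarith

/-- A positive sequence in which each term is a fixed convex combination of the `N` preceding terms,
the last one having positive weight, converges to a positive limit. -/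
theorem exists_tendsto_of_convex_recursion (hN : 0 < N) (hw : ∀ i < N, 0 ≤ w i) (hw0 : 0 < w 0)
    (hsum : ∑ i ∈ Finset.range N, w i = 1)
    (hrec : ∀ n, h (n + N) = ∑ i ∈ Finset.range N, w i * h (n + N - 1 - i))
    (hpos : ∀ n, 0 < h n) : ∃ δ, 0 < δ ∧ Tendsto h atTop (𝓝 δ) := by
  have hw1 : w 0 ≤ 1 := by
    rw [← hsum]
    exact Finset.single_le_sum (f := w) (fun i hi => hw i (Finset.mem_range.1 hi))
      (Finset.mem_range.2 hN)
  have hne : (Finset.range N).Nonempty := ⟨0, Finset.mem_range.2 hN⟩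
  obtain ⟨i₀, -, hi₀⟩ := Finset.exists_min_image (Finset.range N) h hne
  obtain ⟨i₁, -, hi₁⟩ := Finset.exists_max_image (Finset.range N) h hne
  have hb : ∀ k, h i₀ ≤ h (0 + k) ∧ h (0 + k) ≤ h i₁ :=
    bounds_of_window hw hsum hrec fun j hj => by
      rw [zero_add]
      exact ⟨hi₀ j (Finset.mem_range.2 hj), hi₁ j (Finset.mem_range.2 hj)⟩
  have hit : ∀ r : ℕ, ∃ n m M, M - m = (1 - w 0 ^ N) ^ r * (h i₁ - h i₀) ∧
      ∀ k, m ≤ h (n + k) ∧ h (n + k) ≤ M := by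
    intro r
    induction r with
    | zero => exact ⟨0, _, _, by simp, hb⟩
    | succ r ih =>
      obtain ⟨n, m, M, h1, h2⟩ := ih
      obtain ⟨n', m', M', h3, h4⟩ := contract_bounds hN hw hsum hrec h2
      exact ⟨n', m', M', by rw [h3, h1]; ring, h4⟩
  have hρ0 : 0 < w 0 ^ N := pow_pos hw0 N
  have hρ1 : w 0 ^ N ≤ 1 := pow_le_one₀ hw0.le hw1
  have hlim : Tendsto (fun r : ℕ => (1 - w 0 ^ N) ^ r * (h i₁ - h i₀)) atTop (𝓝 0) := by
    have := (tendsto_pow_atTop_nhds_zero_of_lt_one (r := 1 - w 0 ^ N) (by linarith)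
      (by linarith)).mul_const (h i₁ - h i₀)
    simpa using this
  have hcauchy : CauchySeq h := by
    refine Metric.cauchySeq_iff'.2 fun ε hε => ?_
    obtain ⟨r, hr⟩ := (hlim.eventually (gt_mem_nhds hε)).exists
    obtain ⟨n, m, M, h1, h2⟩ := hit r
    refine ⟨n, fun k hk => ?_⟩
    obtain ⟨k, rfl⟩ := Nat.exists_eq_add_of_le hk
    have h3 := h2 k
    have h4 := h2 0
    rw [add_zero] at h4
    rw [Real.dist_eq, abs_lt]
    constructor <;> linarith
  obtain ⟨δ, hδ⟩ := cauchySeq_tendsto_of_complete hcauchy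
  refine ⟨δ, (hpos i₀).trans_le (ge_of_tendsto' hδ fun k => ?_), hδ⟩
  simpa using (hb k).1

end averaging

/-! ### The dominant zero `ψ` -/

section root

variable {L : List ℕ} {ψ : ℝ}

theorem eval_charPoly (L : List ℕ) (x : ℝ) : (charPoly L).eval x =
    x ^ L.length - ∑ i ∈ Finset.range (L.length - 1), (L.getD i 0 : ℝ) * x ^ (L.length - 1 - i)
      - (1 + (L.getD (L.length - 1) 0 : ℝ)) := by
  simp only [charPoly, eval_sub, eval_pow, eval_X, eval_finsetSum, eval_mul, eval_C]

/-- The polynomial is negative at `1` because `a_1 > 0`, and positive far out, so it has a real zero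
above `1`, which the dominant zero bounds. -/
theorem one_lt_of_isDominantRealZero (hN : 2 ≤ L.length) (ha : 0 < L.getD 0 0)
    (hψ : IsDominantRealZero (charPoly L) ψ) : 1 < ψ := by
  obtain ⟨n, hn⟩ : ∃ n, L.length = n + 2 := ⟨L.length - 2, by omega⟩
  set f : ℝ → ℝ := fun x => (charPoly L).eval x with hf
  set S : ℝ := ∑ i ∈ Finset.range (n + 1), (L.getD i 0 : ℝ) with hS
  have hfx : ∀ x, f x = x ^ (n + 2)
      - ∑ i ∈ Finset.range (n + 1), (L.getD i 0 : ℝ) * x ^ (n + 1 - i)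
      - (1 + (L.getD (n + 1) 0 : ℝ)) := fun x => by
    rw [hf]; dsimp only; rw [eval_charPoly, hn]; rfl
  have hS0 : 1 ≤ S := by
    have h1 : (L.getD 0 0 : ℝ) ≤ S := Finset.single_le_sum
      (f := fun i => (L.getD i 0 : ℝ)) (fun i _ => Nat.cast_nonneg _)
      (Finset.mem_range.2 (Nat.succ_pos n))
    exact le_trans (by exact_mod_cast ha) h1
  have hc : (0 : ℝ) ≤ (L.getD (n + 1) 0 : ℝ) := Nat.cast_nonneg _
  have h1 : f 1 < 0 := by
    rw [hfx]
    simp only [one_pow, mul_one, ← hS]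
    linarith
  -- One more than the sum of all the coefficients `a_1, …, a_{N-1}, 1 + a_N`, so that a surplus `R
  -- ^ (n + 1)` remains.
  set R : ℝ := S + (L.getD (n + 1) 0 : ℝ) + 2 with hR
  have hR1 : 1 ≤ R := by linarith
  have hpow : 1 ≤ R ^ (n + 1) := one_le_pow₀ hR1
  have h2 : 0 < f R := by
    rw [hfx]
    have h3 : ∑ i ∈ Finset.range (n + 1), (L.getD i 0 : ℝ) * R ^ (n + 1 - i) ≤
        S * R ^ (n + 1) := by
      rw [hS, Finset.sum_mul]
      exact Finset.sum_le_sum fun i _ => mul_le_mul_of_nonneg_left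
        (pow_le_pow_right₀ hR1 (Nat.sub_le _ _)) (Nat.cast_nonneg _)
    have h4 : (1 + (L.getD (n + 1) 0 : ℝ)) * 1 ≤ (1 + (L.getD (n + 1) 0 : ℝ)) * R ^ (n + 1) :=
      mul_le_mul_of_nonneg_left hpow (by linarith)
    have h5 : R ^ (n + 2) = S * R ^ (n + 1) + (1 + (L.getD (n + 1) 0 : ℝ)) * R ^ (n + 1)
        + R ^ (n + 1) := by rw [pow_succ R (n + 1)]; nth_rewrite 2 [hR]; ring
    linarith
  have hcont : ContinuousOn f (Set.Icc 1 R) := (charPoly L).continuous.continuousOn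
  obtain ⟨r, hr, hr0⟩ := intermediate_value_Icc hR1 hcont ⟨h1.le, h2.le⟩
  have hr1 : 1 < r := by
    rcases hr.1.lt_or_eq with h | h
    · exact h
    · rw [← h] at hr0; linarith
  have h6 := hψ.2 (r : ℂ) (by
    have h7 := Polynomial.aeval_algebraMap_apply ℂ r (charPoly L)
    rw [Complex.coe_algebraMap] at h7
    rw [h7, Polynomial.coe_aeval_eq_eval]
    exact (congrArg (fun y : ℝ => (y : ℂ)) hr0).trans Complex.ofReal_zero)
  rw [Complex.norm_real, Real.norm_eq_abs] at h6
  exact hr1.trans_le ((le_abs_self r).trans h6)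

/-- The characteristic equation divided by `ψ ^ N`; it makes these numbers the weights of a convex
combination. -/
theorem sum_bump_div_pow (hN : 2 ≤ L.length) (hψ1 : 1 < ψ) (hψ : (charPoly L).IsRoot ψ) :
    ∑ i ∈ Finset.range L.length, ((bump L).getD i 0 : ℝ) / ψ ^ (i + 1) = 1 := by
  obtain ⟨n, hn⟩ : ∃ n, L.length = n + 1 := ⟨L.length - 1, by omega⟩
  have hp : (0 : ℝ) < ψ := by linarith
  have h1 := eval_charPoly L ψ
  rw [hψ.eq_zero, hn, Nat.add_sub_cancel] at h1
  rw [hn, Finset.sum_range_succ]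
  have h2 : ((bump L).getD n 0 : ℝ) = 1 + (L.getD n 0 : ℝ) := by
    rw [bump, List.getD_append_right _ _ _ _ (by simp [hn])]
    simp [hn]
  have h3 : ∑ i ∈ Finset.range n, ((bump L).getD i 0 : ℝ) / ψ ^ (i + 1) =
      (∑ i ∈ Finset.range n, (L.getD i 0 : ℝ) * ψ ^ (n - i)) / ψ ^ (n + 1) := by
    rw [Finset.sum_div]
    refine Finset.sum_congr rfl fun i hi => ?_
    rw [Finset.mem_range] at hi
    have e1 : (bump L).getD i 0 = L.getD i 0 := by
      rw [bump, List.getD_append _ _ _ _ (by simp [hn]; omega), hn, Nat.add_sub_cancel]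
      simp [List.getD_eq_getElem?_getD, hi]
    rw [e1, div_eq_div_iff (by positivity) (by positivity), mul_assoc, ← pow_add]
    congr 2
    omega
  rw [h2, h3, ← add_div, div_eq_one_iff_eq (by positivity)]
  linarith

end root

/-! ### Growth of `H` and of padded blocks -/

section growth

variable {L : List ℕ} {H : ℕ → ℕ} {ψ : ℝ}

theorem exists_tendsto_div_pow (hN : 2 ≤ L.length) (ha : 0 < L.getD 0 0)
    (hpos : ∀ n, 1 ≤ n → 0 < H n) (hR : ∀ t, RecursionUpTo (theta L) H t)
    (hψ : IsDominantRealZero (charPoly L) ψ) :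
    ∃ δ, 0 < δ ∧ Tendsto (fun t => (H t : ℝ) / ψ ^ t) atTop (𝓝 δ) := by
  have hψ1 := one_lt_of_isDominantRealZero hN ha hψ
  have hp : (0 : ℝ) < ψ := by linarith
  have hL : L ≠ [] := by rintro rfl; simp at hN
  have hw0 : (0 : ℝ) < ((bump L).getD 0 0 : ℝ) / ψ ^ (0 + 1) := by
    have e1 : (bump L).getD 0 0 = L.getD 0 0 := by
      rw [bump, List.getD_append _ _ _ _ (by simp; omega)]
      rw [List.getD_eq_getElem?_getD, List.getElem?_take_of_lt (by omega),
        ← List.getD_eq_getElem?_getD]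
    rw [e1]
    positivity
  have hrec : ∀ n, (H (n + L.length + 1) : ℝ) / ψ ^ (n + L.length + 1) =
      ∑ i ∈ Finset.range L.length, ((bump L).getD i 0 : ℝ) / ψ ^ (i + 1) *
        ((H (n + L.length - 1 - i + 1) : ℝ) / ψ ^ (n + L.length - 1 - i + 1)) := by
    intro n
    have h1 := convAt_bump hL hR (Nat.le_add_left L.length n)
    rw [convAt_eq_sum (by rw [length_bump hL]; omega), length_bump hL] at h1
    rw [← h1, Nat.cast_sum, Finset.sum_div]
    refine Finset.sum_congr rfl fun i hi => ?_
    rw [Finset.mem_range] at hi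
    rw [show n + L.length - 1 - i + 1 = n + L.length - i by omega, div_mul_div_comm, ← pow_add,
      show i + 1 + (n + L.length - i) = n + L.length + 1 by omega]
    push_cast
    rfl
  obtain ⟨δ, hδ, hlim⟩ := exists_tendsto_of_convex_recursion (N := L.length)
    (w := fun i => ((bump L).getD i 0 : ℝ) / ψ ^ (i + 1))
    (h := fun n => (H (n + 1) : ℝ) / ψ ^ (n + 1)) (by omega) (fun i _ => by positivity) hw0
    (sum_bump_div_pow hN hψ1 hψ.1) hrec fun n => by
      have := hpos (n + 1) (by omega)
      positivity
  exact ⟨δ, hδ, (tendsto_add_atTop_iff_nat (f := fun t => (H t : ℝ) / ψ ^ t) 1).1 hlim⟩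

theorem tendsto_convAt_div_pow (hp : 0 < ψ) {δ : ℝ}
    (hδ : Tendsto (fun t => (H t : ℝ) / ψ ^ t) atTop (𝓝 δ)) (b : List ℕ) :
    Tendsto (fun t => (convAt b H t : ℝ) / ψ ^ t) atTop (𝓝 (δ * dot b (hatSeq ψ))) := by
  have h1 : Tendsto (fun t => ∑ i ∈ Finset.range b.length,
      ((b.getD i 0 : ℝ) * hatSeq ψ (i + 1)) * ((H (t - i) : ℝ) / ψ ^ (t - i))) atTop
      (𝓝 (∑ i ∈ Finset.range b.length, ((b.getD i 0 : ℝ) * hatSeq ψ (i + 1)) * δ)) :=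
    tendsto_finsetSum _ fun i _ => (hδ.comp (tendsto_sub_atTop_nat i)).const_mul _
  rw [← Finset.sum_mul, mul_comm] at h1
  refine h1.congr' ?_
  filter_upwards [eventually_ge_atTop b.length] with t ht
  rw [convAt_eq_sum ht, Nat.cast_sum, Finset.sum_div]
  refine Finset.sum_congr rfl fun i hi => ?_
  rw [Finset.mem_range] at hi
  have e : ψ ^ t = ψ ^ i * ψ ^ (t - i) := by rw [← pow_add]; congr 1; omega
  rw [hatSeq, Nat.add_sub_cancel, e, inv_pow]
  push_cast
  field_simp

end growth

/-! ### Equidistribution of `n α` modulo `1` -/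

/-- The number of `k ∈ {1, …, M}` such that `k α` lies in `[x, x + w)` modulo `1`. -/
noncomputable def visits (α x w : ℝ) (M : ℕ) : ℕ :=
  ((Finset.Icc 1 M).filter fun k : ℕ => Int.fract (k * α - x) < w).card

theorem exists_zmul_add_mem_Ioo {α : ℝ} (hα : Irrational α) {u v : ℝ} (huv : u < v) :
    ∃ j t : ℤ, u < j * α + t ∧ j * α + t < v := by
  have hd : Dense (AddSubgroup.closure {α, 1} : Set ℝ) :=
    dense_addSubgroupClosure_pair_iff.2 (by simpa using hα)
  obtain ⟨y, hy, h1, h2⟩ := hd.exists_between huv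
  obtain ⟨j, t, rfl⟩ := AddSubgroup.mem_closure_pair.1 hy
  exact ⟨j, t, by simpa using h1, by simpa using h2⟩

/-- Disjoint translates of a short interval show that it is not visited too often. -/
theorem exists_mul_visits_le {α : ℝ} (hα : Irrational α) {m : ℕ} (hm : 0 < m) {w : ℝ}
    (hw : w < 1 / m) : ∃ J : ℕ, ∀ x M, m * visits α x w M ≤ M + J := by
  have hm' : (0 : ℝ) < m := by exact_mod_cast hm
  -- Shifting the index by `j i` carries an interval of length `w` into the `i`-th of the `m` equal
  -- cells of the circle.
  choose j t hjt using fun i : ℕ => exists_zmul_add_mem_Ioo hα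
    (show (i : ℝ) / m < i / m + (1 / m - w) by linarith)
  set A : ℕ := ∑ i ∈ Finset.range m, (j i).natAbs with hA
  refine ⟨2 * A, fun x M => ?_⟩
  have hcard : (Finset.Icc (1 - (A : ℤ)) (M + A)).card = M + 2 * A := by
    rw [Int.card_Icc]; omega
  rw [← hcard]
  conv_lhs => rw [← Finset.card_range m]
  rw [visits, ← Finset.card_product]
  -- The shifted point reveals its cell `i`, which makes `(i, k) ↦ k + j i` injective.
  have hfloor : ∀ p ∈ Finset.range m ×ˢ
      (Finset.Icc 1 M).filter (fun k : ℕ => Int.fract (k * α - x) < w),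
      ⌊m * Int.fract ((((p.2 : ℤ) + j p.1 : ℤ) : ℝ) * α - x)⌋ = (p.1 : ℤ) := by
    rintro ⟨i, k⟩ hp
    simp only [Finset.mem_product, Finset.mem_range, Finset.mem_filter] at hp
    obtain ⟨hi, -, hk⟩ := hp
    obtain ⟨h1, h2⟩ := hjt i
    have h0 := Int.fract_nonneg ((k : ℝ) * α - x)
    have hi' : (i : ℝ) + 1 ≤ m := by exact_mod_cast hi
    have hi1 : (i : ℝ) / m + 1 / m ≤ 1 := by rw [← add_div]; exact (div_le_one hm').2 hi'
    have hi0 : (0 : ℝ) ≤ i / m := by positivity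
    have e : Int.fract ((((k : ℤ) + j i : ℤ) : ℝ) * α - x) =
        Int.fract ((k : ℝ) * α - x) + (j i * α + t i) := by
      refine Int.fract_eq_iff.2 ⟨by linarith, by linarith, ⌊(k : ℝ) * α - x⌋ - t i, ?_⟩
      have := Int.self_sub_floor ((k : ℝ) * α - x)
      push_cast
      linarith
    rw [e, Int.floor_eq_iff]
    rw [div_lt_iff₀ hm'] at h1
    have h3 : Int.fract ((k : ℝ) * α - x) + (j i * α + t i) < (i + 1) / m := by
      rw [add_div]; linarith
    rw [lt_div_iff₀ hm'] at h3
    have h4 := mul_nonneg hm'.le h0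
    push_cast
    constructor <;> linarith
  refine Finset.card_le_card_of_injOn (fun p => (p.2 : ℤ) + j p.1) ?_ ?_
  · rintro ⟨i, k⟩ hp
    simp only [Finset.coe_product, Set.mem_prod, Finset.mem_coe, Finset.mem_range,
      Finset.mem_filter, Finset.mem_Icc] at hp
    have : (j i).natAbs ≤ A := Finset.single_le_sum (f := fun i => (j i).natAbs)
      (fun _ _ => Nat.zero_le _) (Finset.mem_range.2 hp.1)
    simp only [Finset.coe_Icc, Set.mem_Icc]
    omega
  · rintro p hp p' hp' h
    dsimp only at h
    have h1 := hfloor p hp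
    rw [h, hfloor p' hp'] at h1
    have h2 : p.1 = p'.1 := by exact_mod_cast h1.symm
    rw [h2] at h
    exact Prod.ext h2 (by exact_mod_cast add_right_cancel h)

theorem visits_add_le (α x : ℝ) {w : ℝ} (hw : 0 ≤ w) (w' : ℝ) (M : ℕ) :
    visits α x (w + w') M ≤ visits α x w M + visits α (x + w) w' M := by
  rw [visits, visits, visits]
  refine le_trans (Finset.card_le_card ?_) (Finset.card_union_le _ _)
  intro k hk
  simp only [Finset.mem_union, Finset.mem_filter] at hk ⊢
  by_cases h : Int.fract ((k : ℝ) * α - x) < w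
  · exact Or.inl ⟨hk.1, h⟩
  · refine Or.inr ⟨hk.1, ?_⟩
    have e : Int.fract ((k : ℝ) * α - (x + w)) = Int.fract ((k : ℝ) * α - x) - w := by
      refine Int.fract_eq_iff.2 ⟨by linarith, ?_, ⌊(k : ℝ) * α - x⌋, ?_⟩
      · linarith [Int.fract_lt_one ((k : ℝ) * α - x)]
      · have := Int.self_sub_floor ((k : ℝ) * α - x)
        linarith
    linarith

theorem visits_mono (α x : ℝ) {w w' : ℝ} (h : w ≤ w') (M : ℕ) :
    visits α x w M ≤ visits α x w' M :=
  Finset.card_le_card fun _ hk => by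
    rw [Finset.mem_filter] at hk ⊢
    exact ⟨hk.1, hk.2.trans_le h⟩

theorem visits_one (α x : ℝ) (M : ℕ) : visits α x 1 M = M := by
  rw [visits, Finset.filter_true_of_mem fun _ _ => Int.fract_lt_one _]
  simp

theorem visits_mul_le {α w : ℝ} (hw : 0 ≤ w) {M b : ℕ} (h : ∀ x, visits α x w M ≤ b) (r : ℕ)
    (x : ℝ) : visits α x (r * w) M ≤ r * b := by
  induction r generalizing x with
  | zero =>
    rw [visits, Finset.filter_false_of_mem fun k _ => not_lt.2 (by simp [Int.fract_nonneg])]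
    simp
  | succ r ih =>
    have h1 := visits_add_le α x hw (r * w) M
    have h2 := h x
    have h3 := ih (x + w)
    rw [show ((r + 1 : ℕ) : ℝ) * w = w + r * w by push_cast; ring, add_mul]
    omega

/-- Cover by `r` intervals of length `1 / (m + 1)`, each visited at most `(M + J) / m` times; for `m
> (w + 1) / ε` rounding `r` up costs at most `ε m`. The constant does not depend on `x`. -/
theorem exists_visits_le {α : ℝ} (hα : Irrational α) {w : ℝ} (hw : 0 ≤ w) {ε : ℝ} (hε : 0 < ε) :
    ∃ C : ℝ, ∀ x M, (visits α x w M : ℝ) ≤ (w + ε) * M + C := by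
  obtain ⟨m, hm⟩ := exists_nat_gt ((w + 1) / ε)
  have hm0 : (0 : ℝ) < m := lt_of_le_of_lt (by positivity) hm
  obtain ⟨J, hJ⟩ := exists_mul_visits_le hα (m := m) (by exact_mod_cast hm0)
    (w := 1 / ((m : ℝ) + 1)) (one_div_lt_one_div_of_lt hm0 (by linarith))
  set r := ⌈w * (m + 1)⌉₊ with hr
  have hr1 : (r : ℝ) < w * (m + 1) + 1 := Nat.ceil_lt_add_one (by positivity)
  have hr2 : w * (m + 1) ≤ r := Nat.le_ceil _
  have hrm : (r : ℝ) ≤ (w + ε) * m := by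
    rw [div_lt_iff₀ hε] at hm
    linarith
  refine ⟨(w + ε) * J, fun x M => ?_⟩
  have h1 : visits α x w M ≤ r * ((M + J) / m) := by
    refine (visits_mono α x ?_ M).trans (visits_mul_le (w := 1 / ((m : ℝ) + 1)) (by positivity)
      (fun x => ?_) r x)
    · rw [mul_one_div, le_div_iff₀ (by positivity)]
      exact hr2
    · rw [Nat.le_div_iff_mul_le (by exact_mod_cast hm0), mul_comm]
      exact hJ x M
  calc (visits α x w M : ℝ) ≤ ((r * ((M + J) / m) : ℕ) : ℝ) := by exact_mod_cast h1
    _ ≤ r * (((M + J : ℕ) : ℝ) / m) := by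
      rw [Nat.cast_mul]
      exact mul_le_mul_of_nonneg_left Nat.cast_div_le (Nat.cast_nonneg _)
    _ ≤ ((w + ε) * m) * (((M + J : ℕ) : ℝ) / m) :=
      mul_le_mul_of_nonneg_right hrm (by positivity)
    _ = (w + ε) * M + (w + ε) * J := by push_cast; field_simp

/-- The upper bound applied to the complementary arc. Negative `w` is allowed because an interval
shrunk at both ends may have negative nominal length. -/
theorem exists_le_visits {α : ℝ} (hα : Irrational α) {w : ℝ} (hw : w ≤ 1) {ε : ℝ} (hε : 0 < ε) :
    ∃ C : ℝ, ∀ x M, (w - ε) * M - C ≤ visits α x w M := by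
  rcases le_or_gt 0 w with h0 | h0
  · obtain ⟨C, hC⟩ := exists_visits_le hα (sub_nonneg.2 hw) hε
    refine ⟨C, fun x M => ?_⟩
    have h1 := visits_add_le α x h0 (1 - w) M
    rw [add_sub_cancel, visits_one] at h1
    have h2 : (M : ℝ) ≤ visits α x w M + visits α (x + w) (1 - w) M := by exact_mod_cast h1
    linarith [hC (x + w) M]
  · refine ⟨0, fun x M => ?_⟩
    have h1 : (w - ε) * M ≤ 0 :=
      mul_nonpos_of_nonpos_of_nonneg (by linarith) (Nat.cast_nonneg _)
    have h2 : (0 : ℝ) ≤ visits α x w M := Nat.cast_nonneg _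
    linarith

/-- A property which holds, up to small errors, if and only if `n α` lies in an interval of length
`w ≤ 1` modulo `1`, has probability `w`. -/
theorem hasProb_of_sandwich {α : ℝ} (hα : Irrational α) {P : ℕ → Prop} {w x : ℝ} (hw0 : 0 ≤ w)
    (hw1 : w ≤ 1)
    (h : ∀ η : ℝ, 0 < η → ∀ᶠ n : ℕ in atTop,
      (Int.fract (n * α - (x + η)) < w - 2 * η → P n) ∧
        (P n → Int.fract (n * α - (x - η)) < w + 2 * η)) : HasProb P w := by
  classical
  refine Metric.tendsto_atTop'.2 fun ε hε => ?_
  set η := ε / 6 with hη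
  have hη0 : 0 < η := by positivity
  obtain ⟨n₀, hn₀⟩ := eventually_atTop.1 (h η hη0)
  obtain ⟨C₁, hC₁⟩ := exists_visits_le hα (w := w + 2 * η) (by positivity) hη0
  obtain ⟨C₂, hC₂⟩ := exists_le_visits hα (w := w - 2 * η) (by linarith) hη0
  -- From `n₁` on, the additive constants and the `n₀` uncontrolled indices together cost less than
  -- `η * M`; with `3 * η * M` from the counting bounds this stays below `ε * M`.
  obtain ⟨n₁, hn₁⟩ := exists_nat_gt ((|C₁| + |C₂| + n₀) / η)
  refine ⟨n₁, fun M hM => ?_⟩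
  have hM' : (n₁ : ℝ) < M := by exact_mod_cast hM
  have hM0 : (0 : ℝ) < M := lt_of_le_of_lt (Nat.cast_nonneg _) hM'
  have hbig : |C₁| + |C₂| + n₀ < η * M := by
    rw [← div_lt_iff₀' hη0]; exact hn₁.trans hM'
  have e : {k : ℕ | P k ∧ 1 ≤ k ∧ k ≤ M} = ((Finset.Icc 1 M).filter P : Finset ℕ) := by
    ext k; simp [and_comm]
  rw [e, Set.ncard_coe_finset]
  set c := ((Finset.Icc 1 M).filter P).card with hc
  have hup : c ≤ n₀ + visits α (x - η) (w + 2 * η) M := by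
    rw [hc, visits]
    conv_rhs => rw [← Finset.card_range n₀]
    refine le_trans (Finset.card_le_card ?_) (Finset.card_union_le _ _)
    intro k hk
    simp only [Finset.mem_union, Finset.mem_filter, Finset.mem_range] at hk ⊢
    by_cases hkn : k < n₀
    · exact Or.inl hkn
    · exact Or.inr ⟨hk.1, (hn₀ k (not_lt.1 hkn)).2 hk.2⟩
  have hlow : visits α (x + η) (w - 2 * η) M ≤ n₀ + c := by
    rw [hc, visits]
    conv_rhs => rw [← Finset.card_range n₀]
    refine le_trans (Finset.card_le_card ?_) (Finset.card_union_le _ _)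
    intro k hk
    simp only [Finset.mem_union, Finset.mem_filter, Finset.mem_range] at hk ⊢
    by_cases hkn : k < n₀
    · exact Or.inl hkn
    · exact Or.inr ⟨hk.1, (hn₀ k (not_lt.1 hkn)).1 hk.2⟩
  have hup' : (c : ℝ) ≤ n₀ + visits α (x - η) (w + 2 * η) M := by exact_mod_cast hup
  have hlow' : (visits α (x + η) (w - 2 * η) M : ℝ) ≤ n₀ + c := by exact_mod_cast hlow
  have h1 := hC₁ (x - η) M
  have h2 := hC₂ (x + η) M
  have h3 := le_abs_self C₁
  have h4 := le_abs_self C₂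
  have h5 := abs_nonneg C₁
  have h6 := abs_nonneg C₂
  have h7 : (0 : ℝ) < η * M := by positivity
  rw [Real.dist_eq, abs_lt, lt_sub_iff_add_lt, sub_lt_iff_lt_add, div_lt_iff₀ hM0,
    lt_div_iff₀ hM0, show ε = 6 * η by rw [hη]; ring]
  constructor <;> linarith

/-! ### Logarithmic asymptotics of `K` and of the interval endpoints -/

theorem one_lt_of_isEquivalent_pow {K : ℕ → ℕ} (hK : ∀ n, 1 ≤ n → 0 < K n) {a b : ℝ}
    (hb : 0 < b) (hb1 : b ≠ 1)
    (h : (fun n : ℕ => (K n : ℝ)) ~[atTop] (fun n : ℕ => a * b ^ n)) : 1 < b := by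
  refine (lt_or_gt_of_ne hb1).resolve_left fun hlt => ?_
  have h1 := (tendsto_pow_atTop_nhds_zero_of_lt_one hb.le hlt).const_mul a
  have h2 := ge_of_tendsto (h.symm.tendsto_nhds h1) (b := (1 : ℝ)) <| by
    filter_upwards [eventually_ge_atTop 1] with n hn
    exact_mod_cast hK n hn
  norm_num at h2

theorem tendsto_logb_sub {ψ : ℝ} (hψ : 1 < ψ) {f : ℕ → ℝ} {d : ℝ} (hd : 0 < d)
    (h : Tendsto (fun t => f t / ψ ^ t) atTop (𝓝 d)) :
    Tendsto (fun t : ℕ => Real.logb ψ (f t) - t) atTop (𝓝 (Real.logb ψ d)) := by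
  refine ((Real.continuousAt_logb hd.ne').tendsto.comp h).congr' ?_
  filter_upwards [h.eventually (lt_mem_nhds hd)] with t ht
  have hp : (0 : ℝ) < ψ ^ t := by positivity
  have hf : f t ≠ 0 := by rintro h0; simp [h0] at ht
  rw [Function.comp_apply, Real.logb_div hf hp.ne', Real.logb_pow, Real.logb_self_eq_one hψ,
    mul_one]

theorem tendsto_logb_sub_of_isEquivalent {ψ : ℝ} {K : ℕ → ℕ}
    (hK : ∀ n, 1 ≤ n → 0 < K n) {a b : ℝ} (ha : 0 < a) (hb : 0 < b)
    (h : (fun n : ℕ => (K n : ℝ)) ~[atTop] (fun n : ℕ => a * b ^ n)) :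
    Tendsto (fun n : ℕ => Real.logb ψ (K n) - (Real.logb ψ a + n * Real.logb ψ b)) atTop
      (𝓝 0) := by
  have h0 : ∀ n : ℕ, a * b ^ n ≠ 0 := fun n => by positivity
  have h1 := (isEquivalent_iff_tendsto_one (Eventually.of_forall h0)).1 h
  have h2 := (Real.continuousAt_logb (b := ψ) one_ne_zero).tendsto.comp h1
  rw [Real.logb_one] at h2
  refine h2.congr' ?_
  filter_upwards [eventually_ge_atTop 1] with n hn
  have hKn : (K n : ℝ) ≠ 0 := by exact_mod_cast (hK n hn).ne'
  rw [Function.comp_apply, Pi.div_apply, Real.logb_div hKn (h0 n),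
    Real.logb_mul ha.ne' (by positivity), Real.logb_pow]

/-- Divide the integer bounds for padded blocks by `ψ ^ t`, let `t → ∞` and cancel `δ`. This places
the claimed probability in `[0, 1]`. -/
theorem dot_tilde_bounds {L : List ℕ} {H : ℕ → ℕ} {ψ δ : ℝ} (hL : L ≠ [])
    (hH : IsFundamentalSequence (collection L) H) (hR : ∀ t, RecursionUpTo (theta L) H t)
    (hψ : 1 < ψ) (hδ : 0 < δ) (hlim : Tendsto (fun t => (H t : ℝ) / ψ ^ t) atTop (𝓝 δ)) {s : ℕ}
    (hs : 1 ≤ s) {B : List ℕ} (hB : B ∈ leadingBlocks L H s) :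
    1 ≤ dot B (hatSeq ψ) ∧ dot B (hatSeq ψ) ≤ dot (tilde L H s B) (hatSeq ψ) ∧
      dot (tilde L H s B) (hatSeq ψ) ≤ ψ := by
  have hp : 0 < ψ := by linarith
  have h1 := tendsto_convAt_div_pow hp hlim B
  have h2 := tendsto_convAt_div_pow hp hlim (tilde L H s B)
  have h3 : Tendsto (fun t => (H (t + 1) : ℝ) / ψ ^ t) atTop (𝓝 (δ * ψ)) := by
    refine (((tendsto_add_atTop_iff_nat 1).2 hlim).mul_const ψ).congr fun t => ?_
    rw [pow_succ]
    field_simp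
  have hb : ∀ᶠ t in atTop, H t ≤ convAt B H t ∧ convAt B H t ≤ convAt (tilde L H s B) H t ∧
      convAt (tilde L H s B) H t ≤ H (t + 1) := by
    filter_upwards [eventually_ge_atTop (max s L.length)] with t ht
    exact convAt_tilde_bounds hL hH hR hs hB ht
  refine ⟨le_of_mul_le_mul_left ?_ hδ, le_of_mul_le_mul_left ?_ hδ, le_of_mul_le_mul_left ?_ hδ⟩
  · rw [mul_one]
    refine le_of_tendsto_of_tendsto hlim h1 (hb.mono fun t ht => ?_)
    exact div_le_div_of_nonneg_right (by exact_mod_cast ht.1) (by positivity)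
  · refine le_of_tendsto_of_tendsto h1 h2 (hb.mono fun t ht => ?_)
    exact div_le_div_of_nonneg_right (by exact_mod_cast ht.2.1) (by positivity)
  · refine le_of_tendsto_of_tendsto h2 h3 (hb.mono fun t ht => ?_)
    exact div_le_div_of_nonneg_right (by exact_mod_cast ht.2.2) (by positivity)

end GenZeckendorf

/-! ### The limit law -/

open GenZeckendorf

theorem theorem5p5 (L : List ℕ) (hN : 2 ≤ L.length) (ha : 0 < L.getD 0 0)
    (H : ℕ → ℕ)
    (hH : GenZeckendorf.IsFundamentalSequence (GenZeckendorf.collection L) H)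
    (ψ : ℝ) (hψ : GenZeckendorf.IsDominantRealZero (GenZeckendorf.charPoly L) ψ)
    (K : ℕ → ℕ) (hK : ∀ n, 1 ≤ n → 0 < K n)
    (a b : ℝ) (hapos : 0 < a) (hbpos : 0 < b)
    (hKab : (fun n : ℕ => (K n : ℝ)) ~[atTop] (fun n : ℕ => a * b ^ n))
    (hirr : Irrational (Real.logb ψ b))
    (s : ℕ) (hs : 1 ≤ s) (B : List ℕ) (hB : B ∈ GenZeckendorf.leadingBlocks L H s) :
    GenZeckendorf.HasProb (fun n => GenZeckendorf.IsLB L H s (K n) B)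
      (Real.logb ψ
        (GenZeckendorf.dot (GenZeckendorf.tilde L H s B) (GenZeckendorf.hatSeq ψ)
          / GenZeckendorf.dot B (GenZeckendorf.hatSeq ψ))) := by
  have hL : L ≠ [] := by rintro rfl; simp at hN
  have hR : ∀ t, RecursionUpTo (theta L) H t := hH.recursion (by simpa [theta] using ha)
  have hψ1 := one_lt_of_isDominantRealZero hN ha hψ
  have hp : 0 < ψ := by linarith
  obtain ⟨δ, hδ, hlim⟩ := exists_tendsto_div_pow hN ha hH.1 hR hψ
  obtain ⟨hd1, hd2, hd3⟩ := dot_tilde_bounds hL hH hR hψ1 hδ hlim hs hB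
  have hd0 := one_pos.trans_le hd1
  have hd0' := hd0.trans_le hd2
  have hlog1 := tendsto_logb_sub hψ1 (mul_pos hδ hd0) (tendsto_convAt_div_pow hp hlim B)
  have hlog2 := tendsto_logb_sub hψ1 (mul_pos hδ hd0')
    (tendsto_convAt_div_pow hp hlim (tilde L H s B))
  have hbounds := fun t ht => convAt_tilde_bounds hL hH hR hs hB (t := t) ht
  have hLB := fun T m hT hm => isLB_iff hL hH hR hs hB (T := T) (m := m) hT hm
  set d := dot B (hatSeq ψ)
  set d' := dot (tilde L H s B) (hatSeq ψ)
  set α := Real.logb ψ b with hα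
  have hb1 : 1 < b := by
    refine one_lt_of_isEquivalent_pow hK hbpos ?_ hKab
    rintro rfl
    rw [hα, Real.logb_one] at hirr
    exact hirr.ne_zero rfl
  have hα0 : 0 < α := Real.logb_pos hψ1 hb1
  have hlogK := tendsto_logb_sub_of_isEquivalent (ψ := ψ) hK hapos hbpos hKab
  rw [← hα] at hlogK
  have hKtop : Tendsto K atTop atTop := tendsto_natCast_atTop_iff.1
    (hKab.symm.tendsto_atTop ((tendsto_pow_atTop_atTop_of_one_lt hb1).const_mul_atTop hapos))
  have hw : Real.logb ψ (d' / d) = Real.logb ψ (δ * d') - Real.logb ψ (δ * d) := by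
    rw [← Real.logb_div (mul_pos hδ hd0').ne' (mul_pos hδ hd0).ne', mul_div_mul_left _ _ hδ.ne']
  -- With this `x`, `n α - x` approximates `log K_n - log (δ d)`, whose integer part should be the
  -- length `t` of the expansion.
  refine hasProb_of_sandwich hirr (x := Real.logb ψ (δ * d) - Real.logb ψ a)
    (Real.logb_nonneg hψ1 ((one_le_div hd0).2 hd2)) ?_ fun η hη => ?_
  · rw [Real.logb_le_iff_le_rpow hψ1 (div_pos hd0' hd0), Real.rpow_one, div_le_iff₀ hd0]
    nlinarith
  rw [hw]
  set A := Real.logb ψ (δ * d)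
  set A' := Real.logb ψ (δ * d')
  have hclose : ∀ᶠ t : ℕ in atTop, max s L.length ≤ t ∧
      |Real.logb ψ (convAt B H t) - t - A| < η / 2 ∧
      |Real.logb ψ (convAt (tilde L H s B) H t) - t - A'| < η / 2 := by
    filter_upwards [eventually_ge_atTop (max s L.length),
      hlog1.eventually (Metric.ball_mem_nhds A (half_pos hη)),
      hlog2.eventually (Metric.ball_mem_nhds A' (half_pos hη))] with t h1 h2 h3
    exact ⟨h1, h2, h3⟩
  obtain ⟨T, hT⟩ := eventually_atTop.1 hclose
  have hz : Tendsto (fun n : ℕ => (n : ℝ) * α) atTop atTop :=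
    tendsto_natCast_atTop_atTop.atTop_mul_const hα0
  -- The last condition ensures that the length `t₀` read off from the floor below is at least `T`.
  -- The tolerance `η` is split evenly between `K n` and the endpoints.
  filter_upwards [eventually_ge_atTop 1, hKtop.eventually_ge_atTop (H T),
    hlogK.eventually (Metric.ball_mem_nhds 0 (half_pos hη)),
    hz.eventually_ge_atTop (T + A' - Real.logb ψ a)] with n hn1 hnH hnK hnz
  rw [Real.dist_eq, sub_zero, abs_lt] at hnK
  have hKn : (0 : ℝ) < K n := by exact_mod_cast hK n hn1
  have hposB : ∀ t, T ≤ t → (0 : ℝ) < convAt B H t ∧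
      (0 : ℝ) < convAt (tilde L H s B) H t := fun t ht => by
    have h1 := hbounds t (hT t ht).1
    have h2 := hH.1 t (hs.trans ((le_max_left _ _).trans (hT t ht).1))
    constructor
    · exact_mod_cast h2.trans_le h1.1
    · exact_mod_cast h2.trans_le (h1.1.trans h1.2.1)
  rw [hLB T (K n) (hT T le_rfl).1 hnH]
  constructor
  · intro hfr
    set t₀ := ⌊(n : ℝ) * α - (A - Real.logb ψ a + η)⌋ with ht₀
    have h1 := Int.self_sub_floor ((n : ℝ) * α - (A - Real.logb ψ a + η))
    have h2 := Int.fract_nonneg ((n : ℝ) * α - (A - Real.logb ψ a + η))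
    rw [← ht₀] at h1
    have h3 : (T : ℤ) ≤ t₀ := by
      have : (T : ℝ) ≤ t₀ := by linarith
      exact_mod_cast this
    obtain ⟨t, ht⟩ := Int.eq_ofNat_of_zero_le (le_trans (Int.natCast_nonneg T) h3)
    have hTt : T ≤ t := by omega
    rw [ht, Int.cast_natCast] at h1
    obtain ⟨-, h4, h5⟩ := hT t hTt
    rw [abs_lt] at h4 h5
    refine ⟨t, hTt, ?_, ?_⟩
    · have := (Real.logb_lt_logb_iff hψ1 (hposB t hTt).1 hKn).1 (by linarith)
      exact_mod_cast this.le
    · have := (Real.logb_lt_logb_iff hψ1 hKn (hposB t hTt).2).1 (by linarith)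
      exact_mod_cast this
  · rintro ⟨t, hTt, h1, h2⟩
    obtain ⟨-, h4, h5⟩ := hT t hTt
    rw [abs_lt] at h4 h5
    have h6 := (Real.logb_le_logb hψ1 (hposB t hTt).1 hKn).2 (by exact_mod_cast h1)
    have h7 := (Real.logb_lt_logb_iff hψ1 hKn (hposB t hTt).2).2 (by exact_mod_cast h2)
    -- An inequality suffices: replacing `t` by the possibly larger floor only decreases the
    -- difference to be bounded.
    have h8 : (t : ℤ) ≤ ⌊(n : ℝ) * α - (A - Real.logb ψ a - η)⌋ := by
      rw [Int.le_floor, Int.cast_natCast]; linarith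
    have h9 : (t : ℝ) ≤ ⌊(n : ℝ) * α - (A - Real.logb ψ a - η)⌋ := by exact_mod_cast h8
    have h10 := Int.self_sub_floor ((n : ℝ) * α - (A - Real.logb ψ a - η))
    linarith
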